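/- **Machine model.** Algorithms are programs of a unit-cost random access machine over $\mathbb{R}$. It has index registers holding natural numbers (zero, copy, increment, decrement, comparison) and two-dimensional arrays of reals addressed by index registers (the constant $1$, $+,-,\times,\div$, comparison), with sequencing, branching and looping. It may also call primitives from an arbitrary fixed family $\Phi$ of Borel measurable real functions of finitely many real variables (e.g. constants, roots, root finders), applied to an initial segment of a row of an array. Each instruction, test, call and control step costs one step. A randomized program may also draw independent uniform samples from $[0,1]$, at one step each. **Leontief economies.** For non-negative $\mathbf E,\mathbf D\in\mathbb{R}^{n\times n}$ with columns $\mathbf e_j,\mathbf d_j$, an equilibrium of the Leontief economy $(\mathbf E,\mathbf D)$ is a pair $(\mathbf u,\mathbf p)$ with $\mathbf p\ge 0$, $\langle \mathbf d_j,\mathbf p\rangle>0$ and $u_j=\langle \mathbf e_j,\mathbf p\rangle/\langle \mathbf d_j,\mathbf p\rangle$ for all $j$, and $\mathbf D\mathbf u\le \mathbf E\vec{\mathbf 1}$ (demand at most supply). An algorithm for computing equilibria is a deterministic program $W$ whose output, whenever it halts on an economy that has an equilibrium, is an equilibrium of it. Let $T_W(\mathbf E,\mathbf D)\in[0,\infty]$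 be the number of steps of $W$ on $(\mathbf E,\mathbf D)$, where an economy without an equilibrium is charged $0$. Computing a Leontief equilibrium is *in smoothed polynomial time under uniform perturbations* if there are such a $W$ and constants $c>0$ and $k_1,k_2\in\mathbb{N}$ such that for all $n\ge1$, $0<\sigma<1$, $\bar{\mathbf E}\in[0,1]^{n\times n}$ and $\bar{\mathbf D}\in[0,2]^{n\times n}$, $$\mathbb{E}\,\big[T_W\big(\max(\bar{\mathbf E}+\mathbf\Delta^E,0),\ \max(\bar{\mathbf D}+\mathbf\Delta^D,0)\big)\big]\le c\,n^{k_1}\sigma^{-k_2},$$ where the maxima are entrywise and the entries of $\mathbf\Delta^E,\mathbf\Delta^D$ are independent and uniform in $[-\sigma,\sigma]$. **Games.** For $\mathbf A,\mathbf B\in\mathbb{R}^{n\times n}$, an $\epsilon'$-approximate Nash equilibrium is a pair of probability vectors $(\mathbf x,\mathbf y)$ with $\mathbf x^{\top}\mathbf A\mathbf y\ge \tilde{\mathbf x}^{\top}\mathbf A\mathbf y-\epsilon'$ and $\mathbf x^{\top}\mathbf B\mathbf y\ge \mathbf x^{\top}\mathbf B\tilde{\mathbf y}-\epsilon'$ for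 all probability vectors $\tilde{\mathbf x},\tilde{\mathbf y}$. **Lemma.** Suppose that, for a family $\Phi$ of primitives, computing a Leontief equilibrium is in smoothed polynomial time under uniform perturbations. Then there are a randomized program $M$ with the same primitives and constants $c>0$ and $k_1,k_2\in\mathbb{N}$ such that for every $n\ge 1$, all $\mathbf A,\mathbf B\in[1,2]^{n\times n}$ and every $0<\epsilon'<1$, the expected number of steps of $M$ on input $(\mathbf A,\mathbf B,\epsilon')$ is at most $c\,n^{k_1}(1/\epsilon')^{k_2}$, and whenever $M$ halts its output is an $\epsilon'$-approximate Nash equilibrium of $(\mathbf A,\mathbf B)$. -/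

import Mathlib

open scoped ENNReal Matrix

noncomputable section

/-! ### A unit-cost random access machine over the real numbers

The machine has index registers, holding natural numbers, and two-dimensional arrays of reals.
A program is a fixed finite text, so it names finitely many registers and arrays, but each array
has unboundedly many cells. Besides arithmetic, comparisons and control flow it may call
primitives `Φ o` (for instance constants, roots or root finders) on a row of an array, each call
counting one step. The family `Φ` is a parameter: the empty family gives the plain arithmetic
machine. The value of a register grows by at most one per step, so that in `t` steps only rows of
length at most (initial register values + `t`) can be handed to a primitive. -/

namespace RealRAM

/-- A cell `arr[row, col]`, where `row` and `col` are the names of two index registers. -/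
structure Cell where
  arr : ℕ
  row : ℕ
  col : ℕ

/-- Elementary instructions; `ι` is the type of names of the primitives. -/
inductive Instr (ι : Type*) where
  /-- set the register `r` to zero -/
  | zero (r : ℕ)
  /-- increase the register `r` by one -/
  | succ (r : ℕ)
  /-- decrease the register `r` by one (zero stays zero) -/
  | pred (r : ℕ)
  /-- copy the register `r` into the register `dst` -/
  | copy (dst r : ℕ)
  /-- write the real number `1` -/
  | one (dst : Cell)
  | add (dst a b : Cell)
  | sub (dst a b : Cell)
  | mul (dst a b : Cell)
  /-- division, with `x / 0 = 0` -/
  | div (dst a b : Cell)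
  /-- call the primitive `o` on the first `len` entries of a row of an array, where `row` and
  `len` are names of registers -/
  | prim (o : ι) (dst : Cell) (arr row len : ℕ)
  /-- draw a fresh random number, uniform in `[0, 1]` -/
  | rand (dst : Cell)

/-- Tests for branching and looping. -/
inductive Test where
  /-- the register `r` is smaller than the register `r'` -/
  | idxLt (r r' : ℕ)
  /-- the real in cell `a` is at most the real in cell `b` -/
  | realLe (a b : Cell)

/-- Programs. -/
inductive Prog (ι : Type*) where
  | act (a : Instr ι)
  | seq (p q : Prog ι)
  | ite (b : Test) (p q : Prog ι)
  | loop (b : Test) (p : Prog ι)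

/-- A program is deterministic if it contains no `rand` instruction. -/
def Prog.Deterministic {ι : Type*} : Prog ι → Prop
  | .act (.rand _) => False
  | .act _ => True
  | .seq p q => p.Deterministic ∧ q.Deterministic
  | .ite _ p q => p.Deterministic ∧ q.Deterministic
  | .loop _ p => p.Deterministic

/-- Memory contents: index registers, arrays (array name, row, column), and the stream of random
numbers that have not been drawn yet. -/
structure State where
  idx : ℕ → ℕ
  mem : ℕ → ℕ → ℕ → ℝ
  seed : ℕ → ℝ

def State.read (s : State) (c : Cell) : ℝ := s.mem c.arr (s.idx c.row) (s.idx c.col)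

def State.write (s : State) (c : Cell) (v : ℝ) : State :=
  { s with
    mem := fun a i j =>
      if a = c.arr ∧ i = s.idx c.row ∧ j = s.idx c.col then v else s.mem a i j }

def State.setIdx (s : State) (r k : ℕ) : State :=
  { s with idx := Function.update s.idx r k }

def Test.Holds (s : State) : Test → Prop
  | .idxLt r r' => s.idx r < s.idx r'
  | .realLe a b => s.read a ≤ s.read b

/-- Effect of an elementary instruction. -/
def Instr.exec {ι : Type*} (Φ : ι → (r : ℕ) → (Fin r → ℝ) → ℝ) (s : State) : Instr ι → State
  | .zero r => s.setIdx r 0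
  | .succ r => s.setIdx r (s.idx r + 1)
  | .pred r => s.setIdx r (s.idx r - 1)
  | .copy dst r => s.setIdx dst (s.idx r)
  | .one dst => s.write dst 1
  | .add dst a b => s.write dst (s.read a + s.read b)
  | .sub dst a b => s.write dst (s.read a - s.read b)
  | .mul dst a b => s.write dst (s.read a * s.read b)
  | .div dst a b => s.write dst (s.read a / s.read b)
  | .prim o dst arr row len =>
      s.write dst (Φ o (s.idx len) (fun k => s.mem arr (s.idx row) k))
  | .rand dst => { s.write dst (s.seed 0) with seed := fun k => s.seed (k + 1) }

open Classical in
/-- One step of the machine. A configuration is the list of programs still to be run, together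
with the memory contents; the machine has halted when the list is empty. -/
def step {ι : Type*} (Φ : ι → (r : ℕ) → (Fin r → ℝ) → ℝ) :
    List (Prog ι) × State → List (Prog ι) × State
  | ([], s) => ([], s)
  | (.act a :: K, s) => (K, a.exec Φ s)
  | (.seq p q :: K, s) => (p :: q :: K, s)
  | (.ite b p q :: K, s) => if b.Holds s then (p :: K, s) else (q :: K, s)
  | (.loop b p :: K, s) => if b.Holds s then (p :: .loop b p :: K, s) else (K, s)

/-- Started in `s`, the program `p` halts with memory contents `s'`. -/
def HaltsWith {ι : Type*} (Φ : ι → (r : ℕ) → (Fin r → ℝ) → ℝ) (p : Prog ι) (s s' : State) :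
    Prop :=
  ∃ k : ℕ, (step Φ)^[k] ([p], s) = ([], s')

/-- The number of steps that `p` makes from `s` before it halts (`∞` if it does not halt). -/
def runTime {ι : Type*} (Φ : ι → (r : ℕ) → (Fin r → ℝ) → ℝ) (p : Prog ι) (s : State) : ℝ≥0∞ :=
  ⨅ (k : ℕ) (_ : ((step Φ)^[k] ([p], s)).1 = []), (k : ℝ≥0∞)

/-- A matrix as the contents of an array (zero outside the matrix). -/
def ofMatrix {n : ℕ} (M : Matrix (Fin n) (Fin n) ℝ) (i j : ℕ) : ℝ :=
  if h : i < n ∧ j < n then M ⟨i, h.1⟩ ⟨j, h.2⟩ else 0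

/-- The distribution of the random numbers: independent and uniform in `[0, 1]`. -/
def seedLaw : MeasureTheory.Measure (ℕ → unitInterval) :=
  MeasureTheory.Measure.infinitePi (fun _ => MeasureTheory.volume)

end RealRAM

/-! ### Leontief economies -/

namespace Leontief

/-- `(u, p)` is an equilibrium of the Leontief economy with endowment matrix `E` and demand matrix
`D` (rows are goods, columns are traders): prices are non-negative, `u j` is the optimal
utility `⟨e_j, p⟩ / ⟨d_j, p⟩` of trader `j` (which requires `⟨d_j, p⟩ > 0`), and the demand
`∑ j, d_{ij} u_j` for each good `i` is at most its supply `∑ j, e_{ij}`. -/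
def IsEquilibrium {n : ℕ} (E D : Matrix (Fin n) (Fin n) ℝ) (u p : Fin n → ℝ) : Prop :=
  (∀ i, 0 ≤ p i) ∧
  (∀ j, 0 < ∑ i, D i j * p i) ∧
  (∀ j, u j = (∑ i, E i j * p i) / (∑ i, D i j * p i)) ∧
  (∀ i, ∑ j, D i j * u j ≤ ∑ j, E i j)

/-- Initial memory for the input `(E, D)`: the number `n` is in register `0`, and `E`, `D` are in
the arrays `0`, `1`. -/
def input {n : ℕ} (E D : Matrix (Fin n) (Fin n) ℝ) : RealRAM.State where
  idx r := if r = 0 then n else 0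
  mem a i j :=
    if a = 0 then RealRAM.ofMatrix E i j else if a = 1 then RealRAM.ofMatrix D i j else 0
  seed _ := 0

/-- `W` is a (deterministic) algorithm for computing equilibria: on every economy that has an
equilibrium, if `W` halts then row `0` of array `2` and row `0` of array `3` hold the utility
vector and the price vector of an equilibrium. -/
def Computes {ι : Type*} (Φ : ι → (r : ℕ) → (Fin r → ℝ) → ℝ) (W : RealRAM.Prog ι) : Prop :=
  W.Deterministic ∧
  ∀ (n : ℕ) (E D : Matrix (Fin n) (Fin n) ℝ), 1 ≤ n →
    (∀ i j, 0 ≤ E i j) → (∀ i j, 0 ≤ D i j) → (∃ u p, IsEquilibrium E D u p) →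
    ∀ s', RealRAM.HaltsWith Φ W (input E D) s' →
      IsEquilibrium E D (fun j => s'.mem 2 0 j) (fun i => s'.mem 3 0 i)

open Classical in
/-- The complexity `T_W(E, D)` of `W` for solving the economy `(E, D)`; an economy without
equilibria imposes no task and is charged nothing. -/
def solveTime {ι : Type*} (Φ : ι → (r : ℕ) → (Fin r → ℝ) → ℝ) (W : RealRAM.Prog ι) {n : ℕ}
    (E D : Matrix (Fin n) (Fin n) ℝ) : ℝ≥0∞ :=
  if ∃ u p, IsEquilibrium E D u p then RealRAM.runTime Φ W (input E D) else 0

/-- `max (M + Δ, 0)`, entry by entry. -/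
def perturb {n : ℕ} (M : Matrix (Fin n) (Fin n) ℝ) (Δ : Fin n × Fin n → ℝ) :
    Matrix (Fin n) (Fin n) ℝ :=
  Matrix.of fun i j => max (M i j + Δ (i, j)) 0

/-- The law of a matrix of independent entries, uniform in `[-σ, σ]`. -/
def uniformNoise (n : ℕ) (σ : ℝ) : MeasureTheory.Measure (Fin n × Fin n → ℝ) :=
  MeasureTheory.Measure.pi
    (fun _ => ProbabilityTheory.cond MeasureTheory.volume (Set.Icc (-σ) σ))

/-- The expectation of `T_W` over uniform perturbations of magnitude `σ` of `(E, D)`. -/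
def expectedTime {ι : Type*} (Φ : ι → (r : ℕ) → (Fin r → ℝ) → ℝ) (W : RealRAM.Prog ι) {n : ℕ}
    (E D : Matrix (Fin n) (Fin n) ℝ) (σ : ℝ) : ℝ≥0∞ :=
  ∫⁻ Δ, solveTime Φ W (perturb E Δ.1) (perturb D Δ.2)
    ∂((uniformNoise n σ).prod (uniformNoise n σ))

/-- `W` has polynomial smoothed time complexity under uniform perturbations. -/
def HasPolySmoothedComplexity {ι : Type*} (Φ : ι → (r : ℕ) → (Fin r → ℝ) → ℝ)
    (W : RealRAM.Prog ι) : Prop :=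
  ∃ (c : ℝ) (k₁ k₂ : ℕ), 0 < c ∧
    ∀ (n : ℕ) (σ : ℝ), 1 ≤ n → 0 < σ → σ < 1 →
      ∀ E D : Matrix (Fin n) (Fin n) ℝ,
        (∀ i j, 0 ≤ E i j ∧ E i j ≤ 1) → (∀ i j, 0 ≤ D i j ∧ D i j ≤ 2) →
        expectedTime Φ W E D σ ≤ ENNReal.ofReal (c * (n : ℝ) ^ k₁ * (1 / σ) ^ k₂)

/-- Computing an equilibrium of a Leontief economy is in smoothed polynomial time under uniform
perturbations. -/
def InSmoothedPolyTime {ι : Type*} (Φ : ι → (r : ℕ) → (Fin r → ℝ) → ℝ) : Prop :=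
  ∃ W : RealRAM.Prog ι, Computes Φ W ∧ HasPolySmoothedComplexity Φ W

end Leontief

/-! ### Bimatrix games -/

namespace Bimatrix

/-- `(x, y)` is an `ε`-approximate Nash equilibrium of the game `(A, B)`. -/
def IsApproxNash {n : ℕ} (A B : Matrix (Fin n) (Fin n) ℝ) (ε : ℝ) (x y : Fin n → ℝ) : Prop :=
  x ∈ stdSimplex ℝ (Fin n) ∧ y ∈ stdSimplex ℝ (Fin n) ∧
  (∀ x' ∈ stdSimplex ℝ (Fin n), x' ⬝ᵥ A *ᵥ y - ε ≤ x ⬝ᵥ A *ᵥ y) ∧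
  (∀ y' ∈ stdSimplex ℝ (Fin n), x ⬝ᵥ B *ᵥ y' - ε ≤ x ⬝ᵥ B *ᵥ y)

/-- Initial memory for the input `(A, B, ε)` and random numbers `ω`: the number `n` is in
register `0`, `A` and `B` are in the arrays `0` and `1`, and `ε` is in cell `[0, 0]` of
array `2`. -/
def input {n : ℕ} (A B : Matrix (Fin n) (Fin n) ℝ) (ε : ℝ) (ω : ℕ → unitInterval) :
    RealRAM.State where
  idx r := if r = 0 then n else 0
  mem a i j :=
    if a = 0 then RealRAM.ofMatrix A i j else if a = 1 then RealRAM.ofMatrix B i j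
    else if a = 2 ∧ i = 0 ∧ j = 0 then ε else 0
  seed k := ω k

end Bimatrix

end

/-! From a game `(A, B)` one builds an economy with `2n` goods and traders: endowments `I / 2`,
demands `[0, A; Bᵀ, 0] / 2`, and every entry raised by a random amount in `[σ, 3σ]` with `σ = ε /
(512 n)`. Such an amount is `2σ` plus noise uniform in `[-σ, σ]`. Hence the random economy is
exactly a uniform perturbation of a fixed economy with entries in the admissible range, and the
smoothed bound for `W` applies with size `2n` and `1 / σ = 512 n / ε`. Clipping at `0` never acts,
and all demands are positive, so an equilibrium exists for every outcome of the noise. Existence is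
essential twice: only then is the output of `W` guaranteed to be an equilibrium, and only then is
`T_W` the true running time rather than `0`.

An equilibrium yields a Nash equilibrium as follows. Write `v`, `w` for the utilities of the two
groups of traders and `q` for the prices of the first group of goods. The market conditions say, up
to the noise, that every entry of `A w` is at most `1`, with equality at goods of positive price, by
Walras' law. A trader whose own good is free has only noise as income and therefore negligible
utility. So `v` lives almost entirely on best responses to `w`; by symmetry `w` lives almost
entirely on best responses to `v`. Bounds on the price totals and on `∑ v`, `∑ w` keep normalisation
from magnifying the errors (`HalfEquilibrium.regret_le`, `isApproxNash_of_isEquilibrium`).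

Existence of equilibria is a fixed point statement, obtained from a combinatorial lemma of Scarf
type (`IsScarfSystem.exists_dominant_rainbow`). Applied to finer and finer grids on the simplex, it
gives the zero-finding principle `exists_mem_stdSimplex_forall_nonpos`, which is then used for the
excess demand.

The program for the game prepares the economy, runs `W` with all its registers and arrays renamed
out of the way (`Embeds`), and normalises the utilities. It is correct for every random stream,
since it relies only on the range of the noise. The expected time is transported from the random
stream to the noise law (`map_noise`), which needs measurability of the running time and hence of
the primitives. -/

noncomputable section

/-! ### A parity argument in place of Brouwer's fixed point theorem -/

section Dominant

variable {I V : Type*} [Fintype I] [DecidableEq I] [Fintype V] [DecidableEq V]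

/-- `U` is dominant for the orders induced by the functions `r i` if every `y` is, in at least one
of the orders, at most all elements of `U`. -/
def Dominant (r : I → V → ℝ) (U : Finset V) : Prop :=
  ∀ y, ∃ i, ∀ x ∈ U, r i y ≤ r i x

omit [Fintype I] [DecidableEq I] [Fintype V] [DecidableEq V] in
theorem Dominant.mono {r : I → V → ℝ} {U W : Finset V} (h : Dominant r U) (hW : W ⊆ U) :
    Dominant r W := fun y => by
  obtain ⟨i, hi⟩ := h y
  exact ⟨i, fun x hx => hi x (hW hx)⟩

/-- The points that can replace the `k`-th minimum `m k` of a facet. -/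
def facetCandidate (r : I → V → ℝ) (m : I → V) (k : I) (y : V) : Prop :=
  ∀ l, l ≠ k → r l (m l) < r l y

/-- A best candidate in the order of `k`. -/
def IsBestCandidate (r : I → V → ℝ) (m : I → V) (k : I) (x : V) : Prop :=
  facetCandidate r m k x ∧ ∀ y, facetCandidate r m k y → r k y ≤ r k x

/-- `m` selects the minima of `W` in all orders; the minima for `i ≠ j` coincide. -/
structure MinSelection (r : I → V → ℝ) (W : Finset V) (m : I → V) (i j : I) : Prop where
  inj : ∀ i, Function.Injective (r i)
  dom : Dominant r W
  card : W.card + 1 = Fintype.card I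
  mem : ∀ i, m i ∈ W
  min : ∀ i, ∀ x ∈ W, r i (m i) ≤ r i x
  ne : i ≠ j
  eq : m i = m j

omit [DecidableEq I] [Fintype V] [DecidableEq V] in
theorem exists_minSelection {r : I → V → ℝ} {W : Finset V} (inj : ∀ i, Function.Injective (r i))
    (dom : Dominant r W) (card : W.card + 1 = Fintype.card I) (hW : W.Nonempty) :
    ∃ m i j, MinSelection r W m i j := by
  choose m hm hmin using fun i => W.exists_min_image (r i) hW
  obtain ⟨i, -, j, -, hij, h⟩ := Finset.exists_ne_map_eq_of_card_lt_of_maps_to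
    (s := (Finset.univ : Finset I)) (t := W) (f := m) (by rw [Finset.card_univ]; omega)
    (fun i _ => hm i)
  exact ⟨m, i, j, inj, dom, card, hm, hmin, hij, h⟩

namespace MinSelection

variable {r : I → V → ℝ} {W : Finset V} {m : I → V} {i j : I}

omit [Fintype V] [DecidableEq V] [DecidableEq I] in
theorem symm (h : MinSelection r W m i j) : MinSelection r W m j i :=
  { h with ne := h.ne.symm, eq := h.eq.symm }

-- Dominance tested at a point `w` of `W` makes `w` a minimum of `W` in some order, so `m` is onto
-- `W`; the index `i` can be spared because `j` has the same minimum.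
omit [Fintype V] [DecidableEq V] in
theorem exists_eq (h : MinSelection r W m i j) {w : V} (hw : w ∈ W) : ∃ l, l ≠ i ∧ m l = w := by
  obtain ⟨l, hl⟩ := h.dom w
  have hlw : m l = w := h.inj l (le_antisymm (h.min l w hw) (hl _ (h.mem l)))
  by_cases hli : l = i
  · exact ⟨j, h.ne.symm, by rw [← h.eq, ← hli, hlw]⟩
  · exact ⟨l, hli, hlw⟩

-- Without `i`, `m` is a surjection onto `W` between sets of equal size. So `m i = m j` is the only
-- coincidence among the minima.
omit [Fintype V] in
theorem injOn (h : MinSelection r W m i j) {a b : I} (ha : a ≠ i) (hb : b ≠ i)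
    (hab : m a = m b) : a = b := by
  have himg : (Finset.univ.erase i).image m = W := by
    ext w
    simp only [Finset.mem_image, Finset.mem_erase, Finset.mem_univ, and_true]
    refine ⟨?_, fun hw => h.exists_eq hw⟩
    rintro ⟨l, -, rfl⟩
    exact h.mem l
  have hcard : ((Finset.univ.erase i).image m).card = (Finset.univ.erase i).card := by
    rw [himg, Finset.card_erase_of_mem (Finset.mem_univ i), Finset.card_univ, ← h.card]
    omega
  exact Finset.card_image_iff.mp hcard (by simpa using ha) (by simpa using hb) hab

omit [Fintype V] [DecidableEq V] in
theorem notMem_of_candidate (h : MinSelection r W m i j) {x : V} (hx : facetCandidate r m i x) :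
    x ∉ W := fun hxW => by
  obtain ⟨l, hl, rfl⟩ := h.exists_eq hxW
  exact lt_irrefl _ (hx l hl)

-- Dominance of `W` at `y` needs a witnessing order, and being a candidate rules out all orders but
-- `i`.
omit [Fintype V] [DecidableEq V] in
theorem candidate_le (h : MinSelection r W m i j) {y : V} (hy : facetCandidate r m i y) :
    r i y ≤ r i (m i) := by
  obtain ⟨l, hl⟩ := h.dom y
  by_cases hli : l = i
  · exact hli ▸ hl _ (h.mem l)
  · exact absurd (hl _ (h.mem l)) (not_le.mpr (hy l hli))

-- For a candidate `y` the order `i` is a witness, by maximality of `x`. A point that is not a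
-- candidate lies below some minimum `m l` with `l ≠ i`, and this remains a minimum since `x` lies
-- above it.
omit [Fintype V] in
theorem dominant_insert_of_best (h : MinSelection r W m i j) {x : V}
    (hx : IsBestCandidate r m i x) : Dominant r (insert x W) := fun y => by
  by_cases hy : facetCandidate r m i y
  · refine ⟨i, fun z hz => ?_⟩
    rcases Finset.mem_insert.mp hz with rfl | hz
    · exact hx.2 y hy
    · exact (h.candidate_le hy).trans (h.min i z hz)
  · simp only [facetCandidate, not_forall, not_lt] at hy
    obtain ⟨l, hl, hly⟩ := hy
    refine ⟨l, fun z hz => ?_⟩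
    rcases Finset.mem_insert.mp hz with rfl | hz
    · exact hly.trans (hx.1 l hl).le
    · exact hly.trans (h.min l z hz)

-- Let `x` be minimal in the order `k` of the enlarged set. The other orders must supply all points
-- of `W` as minima, which by uniqueness of the coincidence forces `k = i` or `k = j`; then
-- dominance says that `x` is the best candidate for `k`.
omit [Fintype V] in
theorem best_of_dominant_insert (h : MinSelection r W m i j) {x : V} (hxW : x ∉ W)
    (hx : Dominant r (insert x W)) : IsBestCandidate r m i x ∨ IsBestCandidate r m j x := by
  obtain ⟨k, hk⟩ := hx x
  have hw : ∀ w ∈ W, ∃ l, l ≠ k ∧ m l = w ∧ r l w < r l x := by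
    intro w hw
    obtain ⟨l, hl⟩ := hx w
    have hlw : m l = w :=
      h.inj l (le_antisymm (h.min l w hw) (hl _ (Finset.mem_insert_of_mem (h.mem l))))
    have hxw : w ≠ x := fun e => hxW (e ▸ hw)
    have hlx : r l w < r l x :=
      lt_of_le_of_ne (hl x (Finset.mem_insert_self _ _)) fun e => hxw (h.inj l e)
    refine ⟨l, ?_, hlw, hlx⟩
    rintro rfl
    exact absurd (hk w (Finset.mem_insert_of_mem hw)) (not_le.mpr hlx)
  have key : ∀ {i j}, MinSelection r W m i j → k = i → IsBestCandidate r m i x := by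
    intro i j h hki
    subst hki
    refine ⟨fun l hl => ?_, fun y hy => ?_⟩
    · obtain ⟨l', hl', he, hlt⟩ := hw (m l) (h.mem l)
      obtain rfl := h.injOn hl hl' he.symm
      exact hlt
    · obtain ⟨l, hl⟩ := hx y
      by_cases hlk : l = k
      · exact hlk ▸ hl x (Finset.mem_insert_self _ _)
      · exact absurd (hl (m l) (Finset.mem_insert_of_mem (h.mem l))) (not_le.mpr (hy l hlk))
  by_cases hki : k = i
  · exact .inl (key h hki)
  by_cases hkj : k = j
  · exact .inr (key h.symm hkj)
  exfalso
  obtain ⟨l', hl', he, -⟩ := hw (m k) (h.mem k)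
  by_cases hli : l' = i
  · subst hli
    exact hkj (h.injOn hki h.ne.symm (he.symm.trans h.eq))
  · exact hl' (h.injOn hli hki he)

omit [Fintype V] in
theorem dominant_insert_iff (h : MinSelection r W m i j) (x : V) :
    (x ∉ W ∧ Dominant r (insert x W)) ↔
      (IsBestCandidate r m i x ∨ IsBestCandidate r m j x) := by
  refine ⟨fun hx => h.best_of_dominant_insert hx.1 hx.2, ?_⟩
  rintro (hx | hx)
  · exact ⟨h.notMem_of_candidate hx.1, h.dominant_insert_of_best hx⟩
  · exact ⟨h.symm.notMem_of_candidate hx.1, h.symm.dominant_insert_of_best hx⟩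

omit [DecidableEq V] [Fintype I] [DecidableEq I] in
theorem exists_best {k : I} {y : V} (hy : facetCandidate r m k y) :
    ∃ x, IsBestCandidate r m k x := by
  classical
  obtain ⟨x, hx, hmax⟩ := (Finset.univ.filter (facetCandidate r m k)).exists_max_image (r k)
    ⟨y, by simpa using hy⟩
  exact ⟨x, by simpa using hx, fun z hz => hmax z (by simpa using hz)⟩

omit [Fintype V] [DecidableEq V] [DecidableEq I] in
theorem best_unique (h : MinSelection r W m i j) {x y : V}
    (hx : IsBestCandidate r m i x) (hy : IsBestCandidate r m i y) : x = y :=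
  h.inj i (le_antisymm (hy.2 x hx.1) (hx.2 y hy.1))

-- In the order `j`, a candidate for `i` lies strictly above `m j`, a candidate for `j` at most at
-- `m j`.
omit [Fintype V] [DecidableEq V] in
theorem best_ne (h : MinSelection r W m i j) {x y : V}
    (hx : IsBestCandidate r m i x) (hy : IsBestCandidate r m j y) : x ≠ y := by
  rintro rfl
  exact absurd (h.symm.candidate_le hy.1) (not_le.mpr (hx.1 j h.ne.symm))

open Classical in
theorem card_insert_eq_two (h : MinSelection r W m i j) {y z : V}
    (hy : facetCandidate r m i y) (hz : facetCandidate r m j z) :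
    (Finset.univ.filter fun x => x ∉ W ∧ Dominant r (insert x W)).card = 2 := by
  obtain ⟨a, ha⟩ := exists_best hy
  obtain ⟨b, hb⟩ := exists_best hz
  rw [Finset.card_eq_two]
  refine ⟨a, b, h.best_ne ha hb, ?_⟩
  ext x
  simp only [h.dominant_insert_iff, Finset.mem_filter, Finset.mem_univ, true_and,
    Finset.mem_insert, Finset.mem_singleton]
  constructor
  · rintro (hx | hx)
    · exact .inl (h.best_unique hx ha)
    · exact .inr (h.symm.best_unique hx hb)
  · rintro (rfl | rfl)
    · exact .inl ha
    · exact .inr hb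

open Classical in
theorem card_insert_eq_one (h : MinSelection r W m i j) {y : V}
    (hy : facetCandidate r m i y) (hz : ∀ z, ¬ facetCandidate r m j z) :
    (Finset.univ.filter fun x => x ∉ W ∧ Dominant r (insert x W)).card = 1 := by
  obtain ⟨a, ha⟩ := exists_best hy
  rw [Finset.card_eq_one]
  refine ⟨a, ?_⟩
  ext x
  simp only [h.dominant_insert_iff, Finset.mem_filter, Finset.mem_univ, true_and,
    Finset.mem_singleton]
  constructor
  · rintro (hx | hx)
    · exact h.best_unique hx ha
    · exact absurd hx.1 (hz x)
  · rintro rfl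
    exact .inl ha

end MinSelection

/-- Orders on a set of points together with one artificial point `bot i` for each order: `bot i`
is the smallest element of its own order, and lies above all proper points in the others. -/
structure IsScarfSystem (r : I → V → ℝ) (bot : I → V) : Prop where
  inj : ∀ i, Function.Injective (r i)
  bot_le : ∀ i v, r i (bot i) ≤ r i v
  lt_bot : ∀ i j v, j ≠ i → v ∉ Set.range bot → r i v < r i (bot j)
  exists_proper : ∃ v, v ∉ Set.range bot

/-! ### Counting the completions of facets, and the parity argument -/

namespace IsScarfSystem

variable {r : I → V → ℝ} {bot : I → V}

omit [Fintype I] [DecidableEq I] [Fintype V] [DecidableEq V] in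
theorem bot_injective (h : IsScarfSystem r bot) : Function.Injective bot := fun i j hij => by
  by_contra hne
  obtain ⟨v, hv⟩ := h.exists_proper
  have h1 := h.lt_bot i j v (Ne.symm hne) hv
  rw [← hij] at h1
  exact absurd (h.bot_le i v) (not_le.mpr h1)

-- A proper point of `W` bounds all minima, and each `bot k` lies above it in all orders other than
-- `k`. So both replacement problems have a candidate.
open Classical in
theorem card_insert_inner (h : IsScarfSystem r bot) {W : Finset V} (dom : Dominant r W)
    (card : W.card + 1 = Fintype.card I) {t : V} (ht : t ∈ W) (htr : t ∉ Set.range bot) :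
    (Finset.univ.filter fun x => x ∉ W ∧ Dominant r (insert x W)).card = 2 := by
  obtain ⟨m, i, j, hm⟩ := exists_minSelection h.inj dom card ⟨t, ht⟩
  have key : ∀ k, facetCandidate r m k (bot k) := fun k l hl =>
    lt_of_le_of_lt (hm.min l t ht) (h.lt_bot l k t hl.symm htr)
  exact hm.card_insert_eq_two (key i) (key j)

omit [Fintype V] in
theorem dominant_outer (h : IsScarfSystem r bot) (i₀ : I) :
    Dominant r ((Finset.univ.erase i₀).image bot) := fun y => by
  by_cases hy : y ∈ Set.range bot
  · obtain ⟨i, rfl⟩ := hy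
    exact ⟨i, fun x _ => h.bot_le i x⟩
  · refine ⟨i₀, fun x hx => ?_⟩
    obtain ⟨j, hj, rfl⟩ := Finset.mem_image.mp hx
    exact (h.lt_bot i₀ j y (Finset.ne_of_mem_erase hj) hy).le

omit [Fintype V] in
theorem card_outer (h : IsScarfSystem r bot) (i₀ : I) :
    ((Finset.univ.erase i₀).image bot).card + 1 = Fintype.card I := by
  rw [Finset.card_image_of_injective _ h.bot_injective,
    Finset.card_erase_of_mem (Finset.mem_univ _), Finset.card_univ]
  have : 0 < Fintype.card I := Fintype.card_pos_iff.mpr ⟨i₀⟩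
  omega

-- This is the boundary facet that makes the total count odd: any proper point is a candidate for
-- `i₀`, whereas a candidate for the other index `j` would have to lie above `bot j` in the order
-- `i₀`, which no proper point does.
open Classical in
theorem card_insert_outer (h : IsScarfSystem r bot) (i₀ : I) {W : Finset V}
    (hW : W = (Finset.univ.erase i₀).image bot) :
    (Finset.univ.filter fun x => x ∉ W ∧ Dominant r (insert x W)).card = 1 := by
  obtain ⟨t, ht⟩ := h.exists_proper
  -- An empty facet has no minima, so the case of a single order is treated apart; there the only
  -- completion is the largest point.
  rcases W.eq_empty_or_nonempty with he | hne
  · have hI : ∀ i, i = i₀ := by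
      intro i
      by_contra hi
      have : bot i ∈ W := by
        rw [hW]
        exact Finset.mem_image_of_mem _ (Finset.mem_erase.mpr ⟨hi, Finset.mem_univ _⟩)
      simp [he] at this
    obtain ⟨a, -, ha⟩ := Finset.univ.exists_max_image (r i₀) ⟨t, Finset.mem_univ t⟩
    rw [Finset.card_eq_one]
    refine ⟨a, ?_⟩
    ext x
    simp only [he, Finset.notMem_empty, not_false_eq_true, true_and, Finset.mem_filter,
      Finset.mem_univ, Finset.mem_singleton, Dominant]
    constructor
    · intro hx
      obtain ⟨i, hi⟩ := hx a
      rw [hI i] at hi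
      exact h.inj i₀ (le_antisymm (ha x (Finset.mem_univ _)) (hi x (by simp)))
    · rintro rfl y
      exact ⟨i₀, fun z hz => by simp at hz; subst hz; exact ha y (Finset.mem_univ _)⟩
  · have dom : Dominant r W := hW ▸ h.dominant_outer i₀
    have card : W.card + 1 = Fintype.card I := hW ▸ h.card_outer i₀
    obtain ⟨m, i, j, hm⟩ := exists_minSelection h.inj dom card hne
    have hbot : ∀ l, l ≠ i₀ → m l = bot l := fun l hl => by
      have : bot l ∈ W := by
        rw [hW]
        exact Finset.mem_image_of_mem _ (Finset.mem_erase.mpr ⟨hl, Finset.mem_univ _⟩)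
      exact h.inj l (le_antisymm (hm.min l _ this) (h.bot_le l _))
    have key : ∀ {i j}, MinSelection r W m i j → i = i₀ →
        (Finset.univ.filter fun x => x ∉ W ∧ Dominant r (insert x W)).card = 1 := by
      rintro i j hm rfl
      have hij : m i = bot j := hm.eq.trans (hbot j hm.ne.symm)
      refine hm.card_insert_eq_one (y := t) ?_ ?_
      · intro l hl
        rw [hbot l hl]
        exact lt_of_le_of_ne (h.bot_le l t) fun e => ht ⟨l, h.inj l e⟩
      · intro z hz
        have h1 := hz i hm.ne
        rw [hij] at h1
        by_cases hzr : z ∈ Set.range bot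
        · obtain ⟨l, rfl⟩ := hzr
          by_cases hlj : l = j
          · exact lt_irrefl _ (hlj ▸ h1)
          by_cases hli : l = i
          · subst hli
            exact absurd (h.bot_le l (bot j)) (not_le.mpr h1)
          · have h2 := hz l hlj
            rw [hbot l hli] at h2
            exact lt_irrefl _ h2
        · exact lt_asymm h1 (h.lt_bot i j z hm.ne.symm hzr)
    by_cases hi : i = i₀
    · exact key hm hi
    by_cases hj : j = i₀
    · exact key hm.symm hj
    · exact absurd (h.bot_injective (by rw [← hbot i hi, ← hbot j hj, hm.eq])) hm.ne

-- The count is `0` or `2`: if deleting `x` leaves every colour except `i₀` exactly once, then `x`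
-- repeats the colour of exactly one other point `x'`, and only these two can be deleted.
omit [Fintype V] in
open Classical in
theorem even_card_facets (c : V → I) (i₀ : I) {U : Finset V} (hU : U.card = Fintype.card I)
    (hc : U.image c ≠ Finset.univ) :
    Even (U.filter fun x => (U.erase x).image c = Finset.univ.erase i₀).card := by
  rcases (U.filter fun x => (U.erase x).image c = Finset.univ.erase i₀).eq_empty_or_nonempty with
    he | ⟨x, hx⟩
  · simp [he]
  obtain ⟨hxU, hx⟩ := Finset.mem_filter.mp hx
  have hinj : Set.InjOn c (U.erase x) := by
    rw [← Finset.card_image_iff, hx, Finset.card_erase_of_mem hxU,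
      Finset.card_erase_of_mem (Finset.mem_univ _), hU, Finset.card_univ]
  have hcU : U.image c = insert (c x) (Finset.univ.erase i₀) := by
    rw [← hx, ← Finset.image_insert, Finset.insert_erase hxU]
  have hcx : c x ≠ i₀ := fun e => hc (by
    rw [hcU, e, Finset.insert_erase (Finset.mem_univ _)])
  have : c x ∈ (U.erase x).image c := by rw [hx]; simpa using hcx
  obtain ⟨x', hx', hcx'⟩ := Finset.mem_image.mp this
  have hne : x ≠ x' := (Finset.ne_of_mem_erase hx').symm
  have hx'U := Finset.mem_of_mem_erase hx'
  suffices (U.filter fun y => (U.erase y).image c = Finset.univ.erase i₀) = {x, x'} by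
    rw [this, Finset.card_pair hne]; exact even_two
  ext y
  simp only [Finset.mem_filter, Finset.mem_insert, Finset.mem_singleton]
  constructor
  · rintro ⟨hyU, hy⟩
    by_contra hcon
    push Not at hcon
    have hmem : c y ∈ (U.erase y).image c := by
      rw [hy, ← hx]
      exact Finset.mem_image_of_mem _ (Finset.mem_erase.mpr ⟨hcon.1, hyU⟩)
    have hinj' : Set.InjOn c (U.erase y) := by
      rw [← Finset.card_image_iff, hy, Finset.card_erase_of_mem hyU,
        Finset.card_erase_of_mem (Finset.mem_univ _), hU, Finset.card_univ]
    exact hne (hinj' (by simpa using ⟨hxU, hcon.1.symm⟩) (by simpa using ⟨hx'U, hcon.2.symm⟩)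
      hcx'.symm)
  · rintro (rfl | rfl)
    · exact ⟨hxU, hx⟩
    · refine ⟨hx'U, ?_⟩
      rw [← hx]
      ext a
      simp only [Finset.mem_image, Finset.mem_erase]
      constructor
      · rintro ⟨b, ⟨hb, hbU⟩, rfl⟩
        by_cases hbx : b = x
        · exact ⟨y, ⟨hne.symm, hx'U⟩, by rw [hbx, hcx']⟩
        · exact ⟨b, ⟨hbx, hbU⟩, rfl⟩
      · rintro ⟨b, ⟨hb, hbU⟩, rfl⟩
        by_cases hby : b = y
        · exact ⟨x, ⟨hne, hxU⟩, by rw [hby, hcx']⟩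
        · exact ⟨b, ⟨hby, hbU⟩, rfl⟩

/-- A colouring in which each artificial point has its own colour admits a dominant set on which
all colours occur exactly once. -/
theorem exists_dominant_rainbow (h : IsScarfSystem r bot) [Nonempty I] (c : V → I)
    (hc : ∀ i, c (bot i) = i) :
    ∃ U : Finset V, Dominant r U ∧ U.card = Fintype.card I ∧ U.image c = Finset.univ := by
  classical
  by_contra hcon
  push Not at hcon
  obtain ⟨i₀⟩ := ‹Nonempty I›
  set R := Finset.univ.filter fun U : Finset V => Dominant r U ∧ U.card = Fintype.card I
  set D := Finset.univ.filter fun W : Finset V =>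
    Dominant r W ∧ W.card + 1 = Fintype.card I ∧ W.image c = Finset.univ.erase i₀
  set W₀ := (Finset.univ.erase i₀).image bot with hW₀
  -- Double counting of incidences between dominant sets of full size and dominant facets with all
  -- colours but `i₀`. Without a rainbow set the left side is even; the right side is odd because
  -- only the outer facet contributes an odd number.
  have hcount : ∑ U ∈ R, (U.filter fun x => (U.erase x).image c = Finset.univ.erase i₀).card =
      ∑ W ∈ D, (Finset.univ.filter fun x => x ∉ W ∧ Dominant r (insert x W)).card := by
    rw [← Finset.card_sigma, ← Finset.card_sigma]
    refine Finset.card_bij' (fun p _ => ⟨p.1.erase p.2, p.2⟩) (fun p _ => ⟨insert p.2 p.1, p.2⟩)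
      ?_ ?_ ?_ ?_
    · rintro ⟨U, x⟩ hp
      simp only [R, D, Finset.mem_sigma, Finset.mem_filter, Finset.mem_univ, true_and] at hp ⊢
      obtain ⟨⟨h1, h2⟩, h3, h4⟩ := hp
      refine ⟨⟨h1.mono (Finset.erase_subset _ _), ?_, h4⟩, by simp, ?_⟩
      · rw [Finset.card_erase_add_one h3, h2]
      · rwa [Finset.insert_erase h3]
    · rintro ⟨W, x⟩ hp
      simp only [R, D, Finset.mem_sigma, Finset.mem_filter, Finset.mem_univ, true_and] at hp ⊢
      obtain ⟨⟨h1, h2, h3⟩, h4, h5⟩ := hp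
      refine ⟨⟨h5, by rw [Finset.card_insert_of_notMem h4, h2]⟩, by simp, ?_⟩
      rwa [Finset.erase_insert h4]
    · rintro ⟨U, x⟩ hp
      simp only [R, Finset.mem_sigma, Finset.mem_filter, Finset.mem_univ, true_and] at hp ⊢
      rw [Finset.insert_erase hp.2.1]
    · rintro ⟨W, x⟩ hp
      simp only [D, Finset.mem_sigma, Finset.mem_filter, Finset.mem_univ, true_and] at hp ⊢
      rw [Finset.erase_insert hp.2.1]
  have heven : Even (∑ U ∈ R,
      (U.filter fun x => (U.erase x).image c = Finset.univ.erase i₀).card) := by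
    refine Finset.even_sum _ fun U hU => ?_
    simp only [R, Finset.mem_filter, Finset.mem_univ, true_and] at hU
    exact even_card_facets c i₀ hU.2 (hcon U hU.1 hU.2)
  have hodd : Odd (∑ W ∈ D,
      (Finset.univ.filter fun x => x ∉ W ∧ Dominant r (insert x W)).card) := by
    rw [Finset.odd_sum_iff_odd_card_odd]
    suffices (D.filter fun W =>
        Odd (Finset.univ.filter fun x => x ∉ W ∧ Dominant r (insert x W)).card) = {W₀} by
      rw [this]; simp
    ext W
    simp only [D, Finset.mem_filter, Finset.mem_univ, true_and, Finset.mem_singleton]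
    constructor
    · rintro ⟨⟨h1, h2, h3⟩, h4⟩
      -- A facet with a proper point has two completions. One with an odd number consists of
      -- artificial points, and is then determined by its colours.
      have hsub : ∀ t ∈ W, t ∈ Set.range bot := by
        intro t ht
        by_contra htr
        rw [h.card_insert_inner h1 h2 ht htr] at h4
        exact absurd h4 (by decide)
      rw [hW₀, ← h3, Finset.image_image]
      ext t
      simp only [Finset.mem_image, Function.comp]
      constructor
      · intro ht
        obtain ⟨i, rfl⟩ := hsub t ht
        exact ⟨_, ht, by rw [hc]⟩
      · rintro ⟨s, hs, rfl⟩
        obtain ⟨i, rfl⟩ := hsub s hs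
        rwa [hc]
    · rintro rfl
      refine ⟨⟨h.dominant_outer i₀, h.card_outer i₀, ?_⟩, ?_⟩
      · rw [hW₀, Finset.image_image]
        ext t
        simp [hc]
      · rw [h.card_insert_outer i₀ hW₀]
        exact odd_one
  rw [hcount] at heven
  exact (Nat.not_even_iff_odd.mpr hodd) heven

end IsScarfSystem

end Dominant

/-! ### Existence of equilibria -/

section Grid

/-- The grid points of the standard simplex of mesh `1 / m`, scaled by `m`. -/
abbrev SimplexGrid (N m : ℕ) : Type := {a : Fin N → Fin (m + 1) // ∑ i, (a i : ℕ) = m}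

/-- The orders of a Scarf system on the grid, refining the orders by coordinates. -/
def gridRank (N m : ℕ) (i : Fin N) : SimplexGrid N m ⊕ Fin N → ℝ
  | .inl a => ((Fintype.card (SimplexGrid N m) * (a.1 i : ℕ) + Fintype.equivFin _ a : ℕ) : ℝ)
  | .inr j => if j = i then -1 else ((Fintype.card (SimplexGrid N m) * (m + 1) + j : ℕ) : ℝ)

theorem gridRank_inl_lt {N m : ℕ} (i : Fin N) (a : SimplexGrid N m) :
    Fintype.card (SimplexGrid N m) * (a.1 i : ℕ) + (Fintype.equivFin _ a : ℕ) <
      Fintype.card (SimplexGrid N m) * ((a.1 i : ℕ) + 1) := by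
  have := (Fintype.equivFin (SimplexGrid N m) a).2
  rw [Nat.mul_succ]
  omega

/-- The enumeration index is smaller than the factor in front of the coordinate, so it only breaks
ties. -/
theorem le_of_gridRank_le {N m : ℕ} {i : Fin N} {a b : SimplexGrid N m}
    (h : gridRank N m i (.inl a) ≤ gridRank N m i (.inl b)) : (a.1 i : ℕ) ≤ b.1 i := by
  simp only [gridRank, Nat.cast_le] at h
  have h1 := gridRank_inl_lt i b
  have h2 : Fintype.card (SimplexGrid N m) * (a.1 i : ℕ) <
      Fintype.card (SimplexGrid N m) * ((b.1 i : ℕ) + 1) := by omega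
  exact Nat.lt_succ_iff.mp (lt_of_mul_lt_mul_left h2 (Nat.zero_le _))

theorem gridRank_injective {N m : ℕ} (i : Fin N) : Function.Injective (gridRank N m i) := by
  have key : ∀ (a : SimplexGrid N m) (j : Fin N),
      gridRank N m i (.inl a) ≠ gridRank N m i (.inr j) := by
    intro a j h
    simp only [gridRank] at h
    split_ifs at h with hj
    · have : (0 : ℝ) ≤ ((Fintype.card (SimplexGrid N m) * (a.1 i : ℕ) +
        Fintype.equivFin _ a : ℕ) : ℝ) := Nat.cast_nonneg _
      linarith
    · have h1 := gridRank_inl_lt i a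
      have h2 : Fintype.card (SimplexGrid N m) * ((a.1 i : ℕ) + 1) ≤
        Fintype.card (SimplexGrid N m) * (m + 1) := Nat.mul_le_mul_left _ (a.1 i).2
      have h3 := Nat.cast_injective h
      omega
  rintro (a | j) (b | k) h
  · have h1 := le_antisymm (le_of_gridRank_le h.le) (le_of_gridRank_le h.ge)
    simp only [gridRank, Nat.cast_inj, h1] at h
    have h2 : Fintype.equivFin (SimplexGrid N m) a = Fintype.equivFin _ b :=
      Fin.ext (by omega)
    rw [(Fintype.equivFin _).injective h2]
  · exact absurd h (key a k)
  · exact absurd h.symm (key b j)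
  · simp only [gridRank] at h
    have hpos : ∀ j : Fin N, (-1 : ℝ) ≠
        ((Fintype.card (SimplexGrid N m) * (m + 1) + j : ℕ) : ℝ) := fun j hj => by
      have : (0 : ℝ) ≤ ((Fintype.card (SimplexGrid N m) * (m + 1) + j : ℕ) : ℝ) :=
        Nat.cast_nonneg _
      linarith
    split_ifs at h with h1 h2 h2
    · rw [h1, h2]
    · exact absurd h (hpos k)
    · exact absurd h.symm (hpos j)
    · rw [Nat.cast_inj] at h
      exact congrArg _ (Fin.ext (by omega))

theorem exists_simplexGrid_eq {N m : ℕ} (y : Fin N → ℕ) (hy : ∑ i, y i ≤ m) (i₁ : Fin N) :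
    ∃ a : SimplexGrid N m, ∀ i, y i ≤ a.1 i ∧ (i ≠ i₁ → (a.1 i : ℕ) = y i) := by
  set z : Fin N → ℕ := fun i => y i + if i = i₁ then m - ∑ i, y i else 0 with hz
  have hsum : ∑ i, z i = m := by
    simp only [hz, Finset.sum_add_distrib, Finset.sum_ite_eq', Finset.mem_univ, if_true]
    omega
  have hle : ∀ i, z i < m + 1 := fun i => by
    have := Finset.single_le_sum (f := z) (fun _ _ => Nat.zero_le _) (Finset.mem_univ i)
    omega
  refine ⟨⟨fun i => ⟨z i, hle i⟩, hsum⟩, fun i => ⟨?_, fun hi => ?_⟩⟩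
  · simp [hz]
  · simp [hz, hi]

theorem isScarfSystem_gridRank {N m : ℕ} (hN : 0 < N) :
    IsScarfSystem (gridRank N m) (Sum.inr : Fin N → SimplexGrid N m ⊕ Fin N) where
  inj := gridRank_injective
  bot_le := by
    rintro i (a | j)
    · simp only [gridRank, if_true]
      have : (0 : ℝ) ≤ ((Fintype.card (SimplexGrid N m) * (a.1 i : ℕ) +
        Fintype.equivFin _ a : ℕ) : ℝ) := Nat.cast_nonneg _
      linarith
    · simp only [gridRank, if_true]
      split_ifs
      · exact le_rfl
      · have : (0 : ℝ) ≤ ((Fintype.card (SimplexGrid N m) * (m + 1) + j : ℕ) : ℝ) :=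
          Nat.cast_nonneg _
        linarith
  lt_bot := by
    rintro i j (a | k) hj ha
    · simp only [gridRank, if_neg hj, Nat.cast_lt]
      have h1 := gridRank_inl_lt i a
      have h2 : Fintype.card (SimplexGrid N m) * ((a.1 i : ℕ) + 1) ≤
        Fintype.card (SimplexGrid N m) * (m + 1) := Nat.mul_le_mul_left _ (a.1 i).2
      omega
    · exact absurd ⟨k, rfl⟩ ha
  exists_proper := by
    obtain ⟨a, -⟩ := exists_simplexGrid_eq (N := N) (m := m) 0 (by simp) ⟨0, hN⟩
    exact ⟨.inl a, by simp⟩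

/-- For every colouring of the grid, some grid point has, in each direction `i` in which it is not
close to the boundary, a grid point of colour `i` nearby. -/
theorem exists_grid_point_near_all_colours {N m : ℕ} (hN : 0 < N)
    (c : SimplexGrid N m → Fin N) :
    ∃ x₀ : SimplexGrid N m, ∀ i, (x₀.1 i : ℕ) < N ∨
      ∃ x, c x = i ∧ ∀ k, (x.1 k : ℕ) ≤ x₀.1 k + N ∧ (x₀.1 k : ℕ) ≤ x.1 k + N := by
  have : Nonempty (Fin N) := ⟨⟨0, hN⟩⟩
  obtain ⟨U, hdom, -, hU⟩ := (isScarfSystem_gridRank (m := m) hN).exists_dominant_rainbow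
    (Sum.elim c id) (fun _ => rfl)
  have hC : ∀ i, (.inr i) ∉ U → ∃ x, .inl x ∈ U ∧ c x = i := by
    intro i hi
    have : i ∈ U.image (Sum.elim c id) := by rw [hU]; exact Finset.mem_univ i
    obtain ⟨x | j, hx, rfl⟩ := Finset.mem_image.mp this
    · exact ⟨x, hx, rfl⟩
    · exact absurd hx hi
  -- An order `i` with `bot i` in `U` cannot witness dominance at a grid point, as `bot i` is least
  -- in it.
  have hdom' : ∀ y : SimplexGrid N m, ∃ i, .inr i ∉ U ∧
      ∀ x, .inl x ∈ U → (y.1 i : ℕ) ≤ x.1 i := by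
    intro y
    obtain ⟨i, hi⟩ := hdom (.inl y)
    refine ⟨i, fun h => ?_, fun x hx => le_of_gridRank_le (hi _ hx)⟩
    have h1 := hi _ h
    simp only [gridRank, if_true] at h1
    have : (0 : ℝ) ≤ ((Fintype.card (SimplexGrid N m) * (y.1 i : ℕ) +
        Fintype.equivFin _ y : ℕ) : ℝ) := Nat.cast_nonneg _
    linarith
  obtain ⟨y₀, -⟩ := exists_simplexGrid_eq (N := N) (m := m) 0 (by simp) ⟨0, hN⟩
  obtain ⟨i₁, hi₁, -⟩ := hdom' y₀
  obtain ⟨x₀, hx₀, -⟩ := hC i₁ hi₁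
  set σ := Finset.univ.filter fun x : SimplexGrid N m => .inl x ∈ U with hσ
  have hσne : σ.Nonempty := ⟨x₀, by simpa [hσ] using hx₀⟩
  have hmem : ∀ x, x ∈ σ ↔ .inl x ∈ U := fun x => by simp [hσ]
  choose a ha hamin using fun i : Fin N =>
    σ.exists_min_image (fun x => (x.1 i : ℕ)) hσne
  -- The lower corner of the grid points of `U`. Dominance forbids a grid point exceeding `μ` in all
  -- coordinates, so `∑ μ` is within `N` of `m`; since all points of `U` have coordinate sum `m`,
  -- they lie within `N` of the corner.
  set μ : Fin N → ℕ := fun i => if .inr i ∈ U then 0 else (a i).1 i with hμ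
  have hμle : ∀ x ∈ σ, ∀ i, μ i ≤ x.1 i := by
    intro x hx i
    simp only [hμ]
    split_ifs
    · exact Nat.zero_le _
    · exact hamin i x hx
  have hbig : m < ∑ i, μ i + N := by
    by_contra hcon
    push Not at hcon
    obtain ⟨y, hy⟩ := exists_simplexGrid_eq (m := m) (fun i => μ i + 1)
      (by simpa [Finset.sum_add_distrib] using hcon) i₁
    obtain ⟨i, hi, hle⟩ := hdom' y
    have h1 := hle (a i) ((hmem _).mp (ha i))
    have h2 := (hy i).1
    simp only [hμ, if_neg hi] at h2
    omega
  have hlt : ∀ x ∈ σ, ∀ k, (x.1 k : ℕ) < μ k + N := by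
    intro x hx k
    have h1 : ∑ i, (x.1 i : ℕ) = ∑ i, ((x.1 i : ℕ) - μ i) + ∑ i, μ i := by
      rw [← Finset.sum_add_distrib]
      exact Finset.sum_congr rfl fun i _ => (Nat.sub_add_cancel (hμle x hx i)).symm
    have h2 := Finset.single_le_sum (f := fun i => (x.1 i : ℕ) - μ i)
      (fun _ _ => Nat.zero_le _) (Finset.mem_univ k)
    have h3 := x.2
    omega
  refine ⟨x₀, fun i => ?_⟩
  have hx₀' := (hmem x₀).mpr hx₀
  by_cases hi : .inr i ∈ U
  · have := hlt x₀ hx₀' i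
    simp only [hμ, if_pos hi] at this
    exact .inl (by omega)
  · obtain ⟨x, hx, hxi⟩ := hC i hi
    refine .inr ⟨x, hxi, fun k => ?_⟩
    have hx' := (hmem x).mpr hx
    have := hlt x₀ hx₀' k
    have := hlt x hx' k
    have := hμle x₀ hx₀' k
    have := hμle x hx' k
    omega

/-- The point of the standard simplex given by a grid point. -/
def gridPoint {N m : ℕ} (a : SimplexGrid N m) (i : Fin N) : ℝ := (a.1 i : ℕ) / (m : ℝ)

theorem gridPoint_mem {N m : ℕ} (hm : 0 < m) (a : SimplexGrid N m) :
    gridPoint a ∈ stdSimplex ℝ (Fin N) := by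
  refine ⟨fun i => div_nonneg (Nat.cast_nonneg _) (Nat.cast_nonneg _), ?_⟩
  simp only [gridPoint]
  rw [← Finset.sum_div, ← Nat.cast_sum, a.2, div_self (by positivity)]

/-- A zero-finding principle on the standard simplex, equivalent to Brouwer's theorem. -/
theorem exists_mem_stdSimplex_forall_nonpos {N : ℕ} (hN : 0 < N)
    (g : Fin N → (Fin N → ℝ) → ℝ) (hg : ∀ i, ContinuousOn (g i) (stdSimplex ℝ (Fin N)))
    (hex : ∀ p ∈ stdSimplex ℝ (Fin N), ∃ i, g i p ≤ 0)
    (hzero : ∀ p ∈ stdSimplex ℝ (Fin N), ∀ i, p i = 0 → g i p ≤ 0) :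
    ∃ p ∈ stdSimplex ℝ (Fin N), ∀ i, g i p ≤ 0 := by
  have : Nonempty (Fin N) := ⟨⟨0, hN⟩⟩
  -- Colour a point by an index at which `g` is nonpositive.
  choose! c hc using hex
  choose x hx using fun m : ℕ => exists_grid_point_near_all_colours (m := m + 1) hN
    (fun a => c (gridPoint a))
  obtain ⟨p, hp, φ, hφ, hlim⟩ := (isCompact_stdSimplex ℝ (Fin N)).tendsto_subseq
    (x := fun m => gridPoint (x m)) (fun m => gridPoint_mem m.succ_pos _)
  refine ⟨p, hp, fun i => ?_⟩
  by_contra! hi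
  have hpi : 0 < p i := lt_of_le_of_ne (hp.1 i) fun e => absurd (hzero p hp i e.symm) (not_le.mpr hi)
  obtain ⟨δ, hδ, hδg⟩ : ∃ δ > 0, ∀ q ∈ stdSimplex ℝ (Fin N), dist q p < δ → 0 < g i q := by
    have := (hg i) p hp (Ioi_mem_nhds hi)
    rw [Filter.mem_map, Metric.mem_nhdsWithin_iff] at this
    obtain ⟨δ, hδ, h⟩ := this
    exact ⟨δ, hδ, fun q hq hqp => h ⟨hqp, hq⟩⟩
  -- Close enough both to keep `g i` positive and to keep coordinate `i` away from `0`, which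
  -- excludes each alternative for the grid point.
  set η := min δ (p i) with hη
  have hηpos : 0 < η := lt_min hδ hpi
  have h1 : ∀ᶠ m in Filter.atTop, dist (gridPoint (x (φ m))) p < η / 2 :=
    (Metric.tendsto_nhds.mp hlim) _ (half_pos hηpos)
  have h2 : ∀ᶠ m in Filter.atTop, (N : ℝ) / ((φ m : ℝ) + 1) < η / 2 := by
    have ht : Filter.Tendsto (fun m : ℕ => (N : ℝ) / ((m : ℝ) + 1)) Filter.atTop (nhds 0) :=
      Filter.Tendsto.const_div_atTop
        (Filter.tendsto_atTop_add_const_right _ 1 tendsto_natCast_atTop_atTop) _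
    exact (ht.comp hφ.tendsto_atTop).eventually (gt_mem_nhds (half_pos hηpos))
  obtain ⟨m, hm1, hm2⟩ := (h1.and h2).exists
  have hmpos : (0 : ℝ) < (φ m : ℝ) + 1 := by positivity
  rcases hx (φ m) i with h | ⟨y, hy, hyx⟩
  · have h3 := lt_of_le_of_lt (dist_le_pi_dist (gridPoint (x (φ m))) p i) hm1
    rw [Real.dist_eq, abs_lt] at h3
    have h4 : gridPoint (x (φ m)) i < N / ((φ m : ℝ) + 1) := by
      simp only [gridPoint, Nat.cast_add, Nat.cast_one]
      exact div_lt_div_of_pos_right (by exact_mod_cast h) hmpos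
    have := min_le_right δ (p i)
    linarith [h3.1]
  · have h3 : dist (gridPoint y) (gridPoint (x (φ m))) ≤ N / ((φ m : ℝ) + 1) := by
      rw [dist_pi_le_iff (by positivity)]
      intro k
      simp only [gridPoint, Nat.cast_add, Nat.cast_one]
      rw [Real.dist_eq, ← sub_div, abs_div, abs_of_pos hmpos]
      refine div_le_div_of_nonneg_right ?_ hmpos.le
      have e1 : ((y.1 k : ℕ) : ℝ) ≤ ((x (φ m)).1 k : ℕ) + N := by exact_mod_cast (hyx k).1
      have e2 : (((x (φ m)).1 k : ℕ) : ℝ) ≤ (y.1 k : ℕ) + N := by exact_mod_cast (hyx k).2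
      rw [abs_le]
      constructor <;> linarith
    have h4 := hδg (gridPoint y) (gridPoint_mem (Nat.succ_pos _) y) (by
      have := dist_triangle (gridPoint y) (gridPoint (x (φ m))) p
      have := min_le_left δ (p i)
      linarith)
    have h5 := hc (gridPoint y) (gridPoint_mem (Nat.succ_pos _) y)
    rw [hy] at h5
    linarith

end Grid

/-! ### Walras' law and the excess demand -/

namespace Leontief

/-- Walras' law: with utilities `u j = ⟨e_j, p⟩ / ⟨d_j, p⟩`, demand and supply have equal value. -/
theorem walras {n : ℕ} {E D : Matrix (Fin n) (Fin n) ℝ} {u p : Fin n → ℝ}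
    (hD : ∀ j, 0 < ∑ i, D i j * p i)
    (hu : ∀ j, u j = (∑ i, E i j * p i) / (∑ i, D i j * p i)) :
    ∑ i, p i * (∑ j, D i j * u j) = ∑ i, p i * ∑ j, E i j := by
  simp only [Finset.mul_sum]
  rw [Finset.sum_comm, Finset.sum_comm (s := Finset.univ) (f := fun i j => p i * E i j)]
  refine Finset.sum_congr rfl fun j _ => ?_
  have h : u j * (∑ i, D i j * p i) = ∑ i, E i j * p i := by
    rw [hu j, div_mul_cancel₀ _ (hD j).ne']
  rw [Finset.mul_sum] at h
  calc ∑ i, p i * (D i j * u j) = ∑ i, u j * (D i j * p i) :=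
        Finset.sum_congr rfl fun i _ => by ring
    _ = ∑ i, E i j * p i := h
    _ = ∑ i, p i * E i j := Finset.sum_congr rfl fun i _ => by ring

/-- A Leontief economy with positive demands has an equilibrium. -/
theorem exists_isEquilibrium {n : ℕ} (hn : 0 < n) (E D : Matrix (Fin n) (Fin n) ℝ)
    (hD : ∀ i j, 0 < D i j) : ∃ u p, IsEquilibrium E D u p := by
  have hDp : ∀ p ∈ stdSimplex ℝ (Fin n), ∀ j, 0 < ∑ i, D i j * p i := by
    intro p hp j
    refine Finset.sum_pos' (fun i _ => mul_nonneg (hD i j).le (hp.1 i)) ?_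
    by_contra! hcon
    have : ∑ i, p i = 0 := Finset.sum_eq_zero fun i hi => by
      have h1 := hcon i hi
      have h2 := hD i j
      have h3 := hp.1 i
      nlinarith
    rw [hp.2] at this
    exact one_ne_zero this
  set u : (Fin n → ℝ) → Fin n → ℝ := fun p j =>
    (∑ i, E i j * p i) / (∑ i, D i j * p i) with hu
  set z : Fin n → (Fin n → ℝ) → ℝ := fun i p =>
    max ((∑ j, D i j * u p j) - ∑ j, E i j) 0 with hz
  have hzc : ∀ i, ContinuousOn (z i) (stdSimplex ℝ (Fin n)) := by
    intro i
    refine ContinuousOn.sup (ContinuousOn.sub ?_ continuousOn_const) continuousOn_const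
    refine continuousOn_finsetSum _ fun j _ => continuousOn_const.mul ?_
    exact ContinuousOn.div (by fun_prop) (by fun_prop) fun p hp => (hDp p hp j).ne'
  have hz0 : ∀ i p, 0 ≤ z i p := fun i p => le_max_right _ _
  -- These functions sum to `0` over the goods, so they are never all positive. At the point found,
  -- `p i * ∑ z ≤ z i` for all `i`.
  obtain ⟨p, hp, hpz⟩ := exists_mem_stdSimplex_forall_nonpos hn
    (fun i p => p i * (∑ k, z k p) - z i p)
    (fun i => ((continuous_apply i).continuousOn.mul
      (continuousOn_finsetSum _ fun k _ => hzc k)).sub (hzc i))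
    (fun p hp => by
      by_contra! hcon
      have h1 : 0 < ∑ i, (p i * (∑ k, z k p) - z i p) :=
        Finset.sum_pos (fun i _ => hcon i) ⟨⟨0, hn⟩, Finset.mem_univ _⟩
      rw [Finset.sum_sub_distrib, ← Finset.sum_mul, hp.2, one_mul, sub_self] at h1
      exact lt_irrefl _ h1)
    (fun p _ i hi => by
      have := hz0 i p
      simp only [hi]
      linarith)
  refine ⟨u p, p, hp.1, hDp p hp, fun _ => rfl, fun i => ?_⟩
  have hw := walras (E := E) (hDp p hp) (u := u p) fun _ => rfl
  -- Otherwise every good with positive price would be in excess demand, against Walras' law.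
  have hS : ∑ k, z k p = 0 := by
    by_contra hne
    have hSpos : 0 < ∑ k, z k p :=
      lt_of_le_of_ne (Finset.sum_nonneg fun k _ => hz0 k p) (Ne.symm hne)
    have hpos : ∀ i, 0 < p i → 0 < (∑ j, D i j * u p j) - ∑ j, E i j := by
      intro i hi
      by_contra! hcon
      have h1 : z i p = 0 := max_eq_right hcon
      have h2 := hpz i
      rw [h1] at h2
      have := mul_pos hi hSpos
      linarith
    have : 0 < ∑ i, p i * ((∑ j, D i j * u p j) - ∑ j, E i j) := by
      refine Finset.sum_pos' (fun i _ => ?_) ?_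
      · rcases (hp.1 i).eq_or_lt with h | h
        · rw [← h, zero_mul]
        · exact (mul_pos h (hpos i h)).le
      · by_contra! hcon
        have h0 : ∑ i, p i = 0 := Finset.sum_eq_zero fun i hi => by
          by_contra hne
          have h := lt_of_le_of_ne (hp.1 i) (Ne.symm hne)
          exact absurd (hcon i hi) (not_le.mpr (mul_pos h (hpos i h)))
        rw [hp.2] at h0
        exact one_ne_zero h0
    simp only [mul_sub, Finset.sum_sub_distrib, hw, sub_self] at this
    exact lt_irrefl _ this
  have h1 := (Finset.sum_eq_zero_iff_of_nonneg fun k _ => hz0 k p).mp hS i (Finset.mem_univ i)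
  have h2 : (∑ j, D i j * u p j) - ∑ j, E i j ≤ z i p := le_max_left _ _
  linarith

end Leontief

/-! ### From equilibria of perturbed game economies to approximate Nash equilibria -/

namespace Bimatrix

/-- The equilibrium conditions for one half of the goods and traders of the perturbed economy of a
bimatrix game. The traders of this half have utilities `v` and their goods have prices `q`; the
other half has utilities `w` and prices `r`. -/
structure HalfEquilibrium {n : ℕ} (A B : Matrix (Fin n) (Fin n) ℝ) (τ : ℝ)
    (Da Db Dc Ea Eb Ec : Matrix (Fin n) (Fin n) ℝ) (v w q r : Fin n → ℝ) : Prop where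
  v_nonneg : ∀ i, 0 ≤ v i
  w_nonneg : ∀ i, 0 ≤ w i
  q_nonneg : ∀ i, 0 ≤ q i
  r_nonneg : ∀ i, 0 ≤ r i
  A_mem : ∀ i j, 1 ≤ A i j ∧ A i j ≤ 2
  B_mem : ∀ i j, 1 ≤ B i j ∧ B i j ≤ 2
  Da_mem : ∀ i j, 0 ≤ Da i j ∧ Da i j ≤ τ
  Db_mem : ∀ i j, A i j / 2 ≤ Db i j ∧ Db i j ≤ A i j / 2 + τ
  Dc_mem : ∀ i j, B j i / 2 ≤ Dc i j ∧ Dc i j ≤ B j i / 2 + τ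
  Ea_mem : ∀ i j, (if i = j then 1 / 2 else 0) ≤ Ea i j ∧
    Ea i j ≤ (if i = j then 1 / 2 else 0) + τ
  Eb_mem : ∀ i j, 0 ≤ Eb i j ∧ Eb i j ≤ τ
  Ec_mem : ∀ i j, 0 ≤ Ec i j ∧ Ec i j ≤ τ
  market : ∀ i, ∑ j, Da i j * v j + ∑ j, Db i j * w j ≤ ∑ j, Ea i j + ∑ j, Eb i j
  compl : ∀ i, 0 < q i → ∑ j, Da i j * v j + ∑ j, Db i j * w j = ∑ j, Ea i j + ∑ j, Eb i j
  budget : ∀ j, v j * (∑ i, Da i j * q i + ∑ i, Dc i j * r i) =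
    ∑ i, Ea i j * q i + ∑ i, Ec i j * r i

theorem sum_mul_le_mul_sum {n : ℕ} {a b : Fin n → ℝ} {c : ℝ} (ha : ∀ i, a i ≤ c)
    (hb : ∀ i, 0 ≤ b i) : ∑ i, a i * b i ≤ c * ∑ i, b i := by
  rw [Finset.mul_sum]
  exact Finset.sum_le_sum fun i _ => mul_le_mul_of_nonneg_right (ha i) (hb i)

theorem mul_sum_le_sum_mul {n : ℕ} {a b : Fin n → ℝ} {c : ℝ} (ha : ∀ i, c ≤ a i)
    (hb : ∀ i, 0 ≤ b i) : c * ∑ i, b i ≤ ∑ i, a i * b i := by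
  rw [Finset.mul_sum]
  exact Finset.sum_le_sum fun i _ => mul_le_mul_of_nonneg_right (ha i) (hb i)

/-! ### Estimates for one group of traders -/

namespace HalfEquilibrium

variable {n : ℕ} {A B Da Db Dc Ea Eb Ec : Matrix (Fin n) (Fin n) ℝ} {τ : ℝ} {v w q r : Fin n → ℝ}

theorem supply_le (h : HalfEquilibrium A B τ Da Db Dc Ea Eb Ec v w q r) (i : Fin n) :
    ∑ j, Ea i j + ∑ j, Eb i j ≤ 1 / 2 + 2 * (n * τ) := by
  have h1 : ∑ j, Ea i j ≤ ∑ j, ((if i = j then 1 / 2 else 0) + τ) :=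
    Finset.sum_le_sum fun j _ => (h.Ea_mem i j).2
  have h2 : ∑ j, Eb i j ≤ ∑ _j : Fin n, τ := Finset.sum_le_sum fun j _ => (h.Eb_mem i j).2
  simp [Finset.sum_add_distrib] at h1 h2
  linarith

theorem le_supply (h : HalfEquilibrium A B τ Da Db Dc Ea Eb Ec v w q r) (i : Fin n) :
    1 / 2 ≤ ∑ j, Ea i j + ∑ j, Eb i j := by
  have h1 : ∑ j, (if i = j then (1 / 2 : ℝ) else 0) ≤ ∑ j, Ea i j :=
    Finset.sum_le_sum fun j _ => (h.Ea_mem i j).1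
  have h2 : 0 ≤ ∑ j, Eb i j := Finset.sum_nonneg fun j _ => (h.Eb_mem i j).1
  simp at h1
  linarith

theorem half_payoff_le (h : HalfEquilibrium A B τ Da Db Dc Ea Eb Ec v w q r) (i : Fin n) :
    (∑ j, A i j * w j) / 2 ≤ ∑ j, Db i j * w j := by
  rw [Finset.sum_div]
  refine Finset.sum_le_sum fun j _ => ?_
  have := mul_le_mul_of_nonneg_right (h.Db_mem i j).1 (h.w_nonneg j)
  linarith

theorem payoff_le (h : HalfEquilibrium A B τ Da Db Dc Ea Eb Ec v w q r) (i : Fin n) :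
    ∑ j, A i j * w j ≤ 1 + 4 * (n * τ) := by
  have h1 := h.supply_le i
  have h2 := h.market i
  have h3 := h.half_payoff_le i
  have h4 : 0 ≤ ∑ j, Da i j * v j :=
    Finset.sum_nonneg fun j _ => mul_nonneg (h.Da_mem i j).1 (h.v_nonneg j)
  linarith

theorem sum_w_le (h : HalfEquilibrium A B τ Da Db Dc Ea Eb Ec v w q r) (hn : 0 < n)
    (hτ : n * τ ≤ 3 / 512) : ∑ j, w j ≤ 2 := by
  have h1 := h.payoff_le ⟨0, hn⟩
  have h2 := mul_sum_le_sum_mul (fun j => (h.A_mem ⟨0, hn⟩ j).1) h.w_nonneg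
  linarith

/-- A good with positive price clears, so the upper bound of `payoff_le` is nearly attained; the
noise in the demands costs at most `4 τ` because both utility totals are at most `2`. -/
theorem le_payoff (h : HalfEquilibrium A B τ Da Db Dc Ea Eb Ec v w q r) (hn : 0 < n)
    (hτ0 : 0 ≤ τ) (hτ : n * τ ≤ 3 / 512) (hv : ∑ j, v j ≤ 2) {i : Fin n} (hi : 0 < q i) :
    1 - 8 * (n * τ) ≤ ∑ j, A i j * w j := by
  have h1 := h.le_supply i
  have h2 := h.compl i hi
  have h3 := sum_mul_le_mul_sum (fun j => (h.Da_mem i j).2) h.v_nonneg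
  have h4 : ∑ j, Db i j * w j ≤ (∑ j, A i j * w j) / 2 + τ * ∑ j, w j := by
    rw [Finset.sum_div, Finset.mul_sum, ← Finset.sum_add_distrib]
    refine Finset.sum_le_sum fun j _ => ?_
    have := mul_le_mul_of_nonneg_right (h.Db_mem i j).2 (h.w_nonneg j)
    linarith
  have h5 := h.sum_w_le hn hτ
  have h6 : τ ≤ n * τ := le_mul_of_one_le_left hτ0 (by exact_mod_cast hn)
  nlinarith

/-- Trader `j` earns at least `q j / 2` and spends at most `v j` times roughly `∑ r`; summing over
`j` with `∑ v ≤ 2` bounds `∑ q` by `5 ∑ r`. Thus neither group of goods has negligible prices. -/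
theorem prices_le (h : HalfEquilibrium A B τ Da Db Dc Ea Eb Ec v w q r) (hn : 0 < n)
    (hτ0 : 0 ≤ τ) (hτ : n * τ ≤ 3 / 512) (hv : ∑ j, v j ≤ 2) :
    ∑ i, q i + ∑ i, r i ≤ 6 * ∑ i, r i := by
  have hτ1 : τ ≤ 3 / 512 := le_trans (le_mul_of_one_le_left hτ0 (by exact_mod_cast hn)) hτ
  set Q := ∑ i, q i with hQ
  set R := ∑ i, r i with hR
  have hQ0 : 0 ≤ Q := Finset.sum_nonneg fun i _ => h.q_nonneg i
  have hR0 : 0 ≤ R := Finset.sum_nonneg fun i _ => h.r_nonneg i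
  have key : ∀ j, q j / 2 ≤ v j * (τ * Q + (1 + τ) * R) := by
    intro j
    have h1 : ∑ i, Da i j * q i ≤ τ * Q :=
      sum_mul_le_mul_sum (fun i => (h.Da_mem i j).2) h.q_nonneg
    have h2 : ∑ i, Dc i j * r i ≤ (1 + τ) * R := by
      refine sum_mul_le_mul_sum (fun i => ?_) h.r_nonneg
      have := (h.Dc_mem i j).2
      have := (h.B_mem j i).2
      linarith
    have h3 : ∑ i, (if i = j then 1 / 2 else 0) * q i ≤ ∑ i, Ea i j * q i :=
      Finset.sum_le_sum fun i _ => mul_le_mul_of_nonneg_right (h.Ea_mem i j).1 (h.q_nonneg i)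
    have h4 : 0 ≤ ∑ i, Ec i j * r i :=
      Finset.sum_nonneg fun i _ => mul_nonneg (h.Ec_mem i j).1 (h.r_nonneg i)
    simp at h3
    have h5 := h.budget j
    have h6 := mul_le_mul_of_nonneg_left (add_le_add h1 h2) (h.v_nonneg j)
    linarith
  have hsum : Q / 2 ≤ (∑ j, v j) * (τ * Q + (1 + τ) * R) := by
    rw [hQ, Finset.sum_div, Finset.sum_mul]
    exact Finset.sum_le_sum fun j _ => key j
  have h1 : (∑ j, v j) * (τ * Q + (1 + τ) * R) ≤ 2 * (τ * Q + (1 + τ) * R) :=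
    mul_le_mul_of_nonneg_right hv (by positivity)
  nlinarith

/-- With a free good of its own, trader `j` has income at most `τ` times the price total, while a
unit of utility costs at least `∑ r / 2`, a twelfth of that total. -/
theorem utility_le (h : HalfEquilibrium A B τ Da Db Dc Ea Eb Ec v w q r)
    (hP : 0 < ∑ i, q i + ∑ i, r i) (hR : ∑ i, q i + ∑ i, r i ≤ 6 * ∑ i, r i)
    {j : Fin n} (hj : q j = 0) : v j ≤ 12 * τ := by
  have h1 : 0 ≤ ∑ i, Da i j * q i :=
    Finset.sum_nonneg fun i _ => mul_nonneg (h.Da_mem i j).1 (h.q_nonneg i)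
  have h2 : 1 / 2 * ∑ i, r i ≤ ∑ i, Dc i j * r i := by
    refine mul_sum_le_sum_mul (fun i => ?_) h.r_nonneg
    have := (h.Dc_mem i j).1
    have := (h.B_mem j i).1
    linarith
  have h3 : ∑ i, Ea i j * q i ≤ τ * ∑ i, q i := by
    rw [Finset.mul_sum]
    refine Finset.sum_le_sum fun i _ => ?_
    by_cases hij : i = j
    · rw [hij, hj]; simp
    · have := (h.Ea_mem i j).2
      rw [if_neg hij, zero_add] at this
      exact mul_le_mul_of_nonneg_right this (h.q_nonneg i)
  have h4 : ∑ i, Ec i j * r i ≤ τ * ∑ i, r i :=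
    sum_mul_le_mul_sum (fun i => (h.Ec_mem i j).2) h.r_nonneg
  have h5 := h.budget j
  have h6 : v j * ((∑ i, q i + ∑ i, r i) / 12) ≤ v j * (∑ i, Da i j * q i + ∑ i, Dc i j * r i) :=
    mul_le_mul_of_nonneg_left (by linarith) (h.v_nonneg j)
  have h7 : v j * (∑ i, q i + ∑ i, r i) ≤ 12 * τ * (∑ i, q i + ∑ i, r i) := by linarith
  exact le_of_mul_le_mul_right h7 hP

/-- The best response condition for the player whose strategy is `v`, normalised. -/
theorem regret_le (h : HalfEquilibrium A B τ Da Db Dc Ea Eb Ec v w q r) {ε : ℝ}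
    (hn : 0 < n) (hτ0 : 0 ≤ τ) (hε : n * τ ≤ 3 * ε / 512) (hε1 : ε ≤ 1)
    (hP : 0 < ∑ i, q i + ∑ i, r i) (hR : ∑ i, q i + ∑ i, r i ≤ 6 * ∑ i, r i)
    (hv : ∑ j, v j ≤ 2) (hV : 2 / 5 ≤ ∑ j, v j) (hW : 2 / 5 ≤ ∑ j, w j)
    {x' : Fin n → ℝ} (hx' : x' ∈ stdSimplex ℝ (Fin n)) :
    ∑ i, x' i * (∑ j, A i j * (w j / ∑ k, w k)) - ε ≤
      ∑ i, v i / (∑ k, v k) * (∑ j, A i j * (w j / ∑ k, w k)) := by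
  have hτ : n * τ ≤ 3 / 512 := by linarith
  have hnτ : 0 ≤ n * τ := by positivity
  set V := ∑ k, v k with hVdef
  set W := ∑ k, w k with hWdef
  have hV0 : 0 < V := by linarith
  have hW0 : 0 < W := by linarith
  have hdiv : ∀ i, ∑ j, A i j * (w j / W) = (∑ j, A i j * w j) / W := fun i => by
    rw [Finset.sum_div]
    exact Finset.sum_congr rfl fun j _ => by ring
  simp only [hdiv]
  have hup : ∑ i, x' i * ((∑ j, A i j * w j) / W) ≤ (1 + 4 * (n * τ)) / W := by
    have : ∑ i, x' i * ((∑ j, A i j * w j) / W) ≤ ∑ i, x' i * ((1 + 4 * (n * τ)) / W) :=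
      Finset.sum_le_sum fun i _ => mul_le_mul_of_nonneg_left
        (div_le_div_of_nonneg_right (h.payoff_le i) hW0.le) (hx'.1 i)
    rwa [← Finset.sum_mul, hx'.2, one_mul] at this
  -- Strategies with positive price are near-best responses; each of the others has weight at most
  -- `12 τ`.
  have hlow : V * (1 - 8 * (n * τ)) - 12 * (n * τ) ≤ ∑ i, v i * ∑ j, A i j * w j := by
    have : ∑ i, (v i * (1 - 8 * (n * τ)) - 12 * τ) ≤ ∑ i, v i * ∑ j, A i j * w j := by
      refine Finset.sum_le_sum fun i _ => ?_
      rcases (h.q_nonneg i).eq_or_lt with hq | hq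
      · have h1 := h.utility_le hP hR hq.symm
        have h2 : 0 ≤ v i * ∑ j, A i j * w j := mul_nonneg (h.v_nonneg i)
          (Finset.sum_nonneg fun j _ => mul_nonneg (by linarith [(h.A_mem i j).1]) (h.w_nonneg j))
        have h3 := mul_nonneg (h.v_nonneg i) hnτ
        linarith
      · have := mul_le_mul_of_nonneg_left (h.le_payoff hn hτ0 hτ hv hq) (h.v_nonneg i)
        linarith
    simp only [Finset.sum_sub_distrib, ← Finset.sum_mul, Finset.sum_const, Finset.card_univ,
      Fintype.card_fin, nsmul_eq_mul] at this
    linarith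
  have hval : ∑ i, v i / V * ((∑ j, A i j * w j) / W) = (∑ i, v i * ∑ j, A i j * w j) / (V * W) := by
    rw [Finset.sum_div]
    exact Finset.sum_congr rfl fun i _ => by rw [div_mul_div_comm]
  rw [hval]
  have hε' : (1 + 4 * (n * τ)) / W - ε ≤ (V * (1 - 8 * (n * τ)) - 12 * (n * τ)) / (V * W) := by
    rw [div_sub' hW0.ne', div_le_div_iff₀ hW0 (mul_pos hV0 hW0)]
    have h1 : V * (1 + 4 * (n * τ) - W * ε) ≤ V * (1 - 8 * (n * τ)) - 12 * (n * τ) := by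
      -- From `V ≥ 2 / 5`. The total loss `42 n τ V` fits since `42 * 3 / 512 < 2 / 5 ≤ W`.
      have h2 : 12 * (n * τ) ≤ 30 * (n * τ) * V := by nlinarith
      have h3 : 42 * (n * τ) ≤ W * ε := by nlinarith
      nlinarith
    nlinarith
  have := div_le_div_of_nonneg_right hlow (mul_pos hV0 hW0).le
  linarith

end HalfEquilibrium

theorem dotProduct_mulVec_eq {n : ℕ} (A : Matrix (Fin n) (Fin n) ℝ) (x y : Fin n → ℝ) :
    x ⬝ᵥ A *ᵥ y = ∑ i, x i * ∑ j, A i j * y j := rfl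

theorem dotProduct_mulVec_eq' {n : ℕ} (A : Matrix (Fin n) (Fin n) ℝ) (x y : Fin n → ℝ) :
    x ⬝ᵥ A *ᵥ y = ∑ j, y j * ∑ i, A i j * x i := by
  rw [dotProduct_mulVec_eq]
  simp only [Finset.mul_sum]
  rw [Finset.sum_comm]
  exact Finset.sum_congr rfl fun j _ => Finset.sum_congr rfl fun i _ => by ring

/-- `E` and `D` are entrywise at most `τ` above the economy `(I / 2, [0, A; Bᵀ, 0] / 2)` of the
game `(A, B)`. -/
structure NearGameEconomy {n : ℕ} (A B : Matrix (Fin n) (Fin n) ℝ) (τ : ℝ)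
    (E D : Matrix (Fin (n + n)) (Fin (n + n)) ℝ) : Prop where
  E_mem : ∀ i j, (if i = j then 1 / 2 else 0) ≤ E i j ∧ E i j ≤ (if i = j then 1 / 2 else 0) + τ
  D₁₁ : ∀ i j, 0 ≤ D (Fin.castAdd n i) (Fin.castAdd n j) ∧
    D (Fin.castAdd n i) (Fin.castAdd n j) ≤ τ
  D₁₂ : ∀ i j, A i j / 2 ≤ D (Fin.castAdd n i) (Fin.natAdd n j) ∧
    D (Fin.castAdd n i) (Fin.natAdd n j) ≤ A i j / 2 + τ
  D₂₁ : ∀ i j, B j i / 2 ≤ D (Fin.natAdd n i) (Fin.castAdd n j) ∧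
    D (Fin.natAdd n i) (Fin.castAdd n j) ≤ B j i / 2 + τ
  D₂₂ : ∀ i j, 0 ≤ D (Fin.natAdd n i) (Fin.natAdd n j) ∧
    D (Fin.natAdd n i) (Fin.natAdd n j) ≤ τ

theorem isApproxNash_of_isEquilibrium {n : ℕ} (hn : 0 < n) {A B : Matrix (Fin n) (Fin n) ℝ}
    (hA : ∀ i j, 1 ≤ A i j ∧ A i j ≤ 2) (hB : ∀ i j, 1 ≤ B i j ∧ B i j ≤ 2) {ε τ : ℝ}
    (hτ0 : 0 ≤ τ) (hε : n * τ ≤ 3 * ε / 512) (hε1 : ε ≤ 1)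
    {E D : Matrix (Fin (n + n)) (Fin (n + n)) ℝ} (h : NearGameEconomy A B τ E D)
    {u p : Fin (n + n) → ℝ} (heq : Leontief.IsEquilibrium E D u p) :
    IsApproxNash A B ε (fun i => u (Fin.castAdd n i) / ∑ k, u (Fin.castAdd n k))
      (fun j => u (Fin.natAdd n j) / ∑ k, u (Fin.natAdd n k)) := by
  obtain ⟨hp, hDp, hu, hmarket⟩ := heq
  have hE0 : ∀ i j, 0 ≤ E i j := fun i j => le_trans (by split_ifs <;> norm_num) (h.E_mem i j).1
  have hu0 : ∀ j, 0 ≤ u j := fun j => by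
    rw [hu j]
    exact div_nonneg (Finset.sum_nonneg fun i _ => mul_nonneg (hE0 i j) (hp i)) (hDp j).le
  -- Complementary slackness: by Walras' law the nonnegative terms price times excess supply sum to
  -- `0`.
  have hcompl : ∀ i, 0 < p i → ∑ j, D i j * u j = ∑ j, E i j := by
    have hw := Leontief.walras hDp hu
    have h1 : ∑ i, p i * (∑ j, E i j - ∑ j, D i j * u j) = 0 := by
      simp only [mul_sub, Finset.sum_sub_distrib, hw, sub_self]
    rw [Finset.sum_eq_zero_iff_of_nonneg fun i _ =>
      mul_nonneg (hp i) (sub_nonneg.mpr (hmarket i))] at h1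
    intro i hi
    rcases mul_eq_zero.mp (h1 i (Finset.mem_univ i)) with h2 | h2
    · exact absurd h2 hi.ne'
    · linarith
  have hbudget : ∀ j, u j * ∑ i, D i j * p i = ∑ i, E i j * p i := fun j => by
    rw [hu j, div_mul_cancel₀ _ (hDp j).ne']
  have hne : ∀ i j : Fin n, Fin.castAdd n i ≠ Fin.natAdd n j := fun i j e => by
    have := congrArg Fin.val e
    simp at this
    omega
  have hEoff : ∀ i j, i ≠ j → 0 ≤ E i j ∧ E i j ≤ τ := fun i j hij => by
    simpa [hij] using h.E_mem i j
  have H₁ : HalfEquilibrium A B τ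
      (Matrix.of fun i j => D (Fin.castAdd n i) (Fin.castAdd n j))
      (Matrix.of fun i j => D (Fin.castAdd n i) (Fin.natAdd n j))
      (Matrix.of fun i j => D (Fin.natAdd n i) (Fin.castAdd n j))
      (Matrix.of fun i j => E (Fin.castAdd n i) (Fin.castAdd n j))
      (Matrix.of fun i j => E (Fin.castAdd n i) (Fin.natAdd n j))
      (Matrix.of fun i j => E (Fin.natAdd n i) (Fin.castAdd n j))
      (fun i => u (Fin.castAdd n i)) (fun i => u (Fin.natAdd n i))
      (fun i => p (Fin.castAdd n i)) (fun i => p (Fin.natAdd n i)) :=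
    { v_nonneg := fun _ => hu0 _, w_nonneg := fun _ => hu0 _, q_nonneg := fun _ => hp _,
      r_nonneg := fun _ => hp _, A_mem := hA, B_mem := hB, Da_mem := h.D₁₁, Db_mem := h.D₁₂,
      Dc_mem := h.D₂₁
      Ea_mem := fun i j => by simpa using h.E_mem (Fin.castAdd n i) (Fin.castAdd n j)
      Eb_mem := fun i j => hEoff _ _ (hne i j)
      Ec_mem := fun i j => hEoff _ _ (hne j i).symm
      market := fun i => by simpa [Fin.sum_univ_add] using hmarket (Fin.castAdd n i)
      compl := fun i hi => by simpa [Fin.sum_univ_add] using hcompl (Fin.castAdd n i) hi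
      budget := fun i => by simpa [Fin.sum_univ_add] using hbudget (Fin.castAdd n i) }
  -- Exchanging the two groups exchanges the players, hence the transposes.
  have H₂ : HalfEquilibrium Bᵀ Aᵀ τ
      (Matrix.of fun i j => D (Fin.natAdd n i) (Fin.natAdd n j))
      (Matrix.of fun i j => D (Fin.natAdd n i) (Fin.castAdd n j))
      (Matrix.of fun i j => D (Fin.castAdd n i) (Fin.natAdd n j))
      (Matrix.of fun i j => E (Fin.natAdd n i) (Fin.natAdd n j))
      (Matrix.of fun i j => E (Fin.natAdd n i) (Fin.castAdd n j))
      (Matrix.of fun i j => E (Fin.castAdd n i) (Fin.natAdd n j))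
      (fun i => u (Fin.natAdd n i)) (fun i => u (Fin.castAdd n i))
      (fun i => p (Fin.natAdd n i)) (fun i => p (Fin.castAdd n i)) :=
    { v_nonneg := fun _ => hu0 _, w_nonneg := fun _ => hu0 _, q_nonneg := fun _ => hp _,
      r_nonneg := fun _ => hp _, A_mem := fun i j => hB j i, B_mem := fun i j => hA j i,
      Da_mem := h.D₂₂, Db_mem := h.D₂₁, Dc_mem := h.D₁₂
      Ea_mem := fun i j => by simpa using h.E_mem (Fin.natAdd n i) (Fin.natAdd n j)
      Eb_mem := fun i j => hEoff _ _ (hne j i).symm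
      Ec_mem := fun i j => hEoff _ _ (hne i j)
      market := fun i => by simpa [Fin.sum_univ_add, add_comm] using hmarket (Fin.natAdd n i)
      compl := fun i hi => by
        simpa [Fin.sum_univ_add, add_comm] using hcompl (Fin.natAdd n i) hi
      budget := fun i => by
        simpa [Fin.sum_univ_add, add_comm] using hbudget (Fin.natAdd n i) }
  have hτ : n * τ ≤ 3 / 512 := by linarith
  have hw2 := H₁.sum_w_le hn hτ
  have hv2 := H₂.sum_w_le hn hτ
  have hR := H₁.prices_le hn hτ0 hτ hv2
  have hQ := H₂.prices_le hn hτ0 hτ hw2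
  have hP : 0 < ∑ i, p (Fin.castAdd n i) + ∑ i, p (Fin.natAdd n i) := by
    rw [← Fin.sum_univ_add]
    refine Finset.sum_pos' (fun i _ => hp i) ?_
    by_contra! hcon
    have h0 : ∀ i, p i = 0 := fun i => le_antisymm (hcon i (Finset.mem_univ i)) (hp i)
    have := hDp ⟨0, by omega⟩
    simp [h0] at this
  have hP' := (add_comm _ _).trans_gt hP
  have hpos : ∀ f : Fin n → ℝ, (∀ i, 0 ≤ f i) → 0 < ∑ i, f i → ∃ i, 0 < f i := by
    intro f _ hf
    obtain ⟨i, -, hi⟩ := Finset.exists_lt_of_sum_lt (s := Finset.univ) (f := fun _ => (0 : ℝ))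
      (g := f) (by simpa using hf)
    exact ⟨i, hi⟩
  obtain ⟨i, hi⟩ := hpos _ H₁.q_nonneg (by linarith)
  obtain ⟨j, hj⟩ := hpos _ H₁.r_nonneg (by linarith)
  -- A good of positive price has payoff at least `1 - 24 / 512`, while the entries of `A` are at
  -- most `2`.
  have hW : 2 / 5 ≤ ∑ j, u (Fin.natAdd n j) := by
    have h1 := H₁.le_payoff hn hτ0 hτ hv2 hi
    have h2 := sum_mul_le_mul_sum (fun j => (hA i j).2) H₁.w_nonneg
    linarith
  have hV : 2 / 5 ≤ ∑ j, u (Fin.castAdd n j) := by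
    have h1 := H₂.le_payoff hn hτ0 hτ hw2 hj
    have h2 := sum_mul_le_mul_sum (fun i => (hB i j).2) H₂.w_nonneg
    simp only [Matrix.transpose_apply] at h1
    linarith
  refine ⟨⟨fun i => div_nonneg (hu0 _) (by linarith), ?_⟩,
    ⟨fun i => div_nonneg (hu0 _) (by linarith), ?_⟩, fun x' hx' => ?_, fun y' hy' => ?_⟩
  · rw [← Finset.sum_div, div_self (by linarith)]
  · rw [← Finset.sum_div, div_self (by linarith)]
  · simpa only [dotProduct_mulVec_eq] using
      H₁.regret_le hn hτ0 hε hε1 hP hR hv2 hV hW hx'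
  · simpa only [dotProduct_mulVec_eq', Matrix.transpose_apply] using
      H₂.regret_le hn hτ0 hε hε1 hP' hQ hw2 hW hV hy'

end Bimatrix

/-! ### Semantics of programs -/

namespace RealRAM

section Semantics

variable {ι : Type*} {Φ : ι → (r : ℕ) → (Fin r → ℝ) → ℝ}

/-- Run on top of any control stack, `p` leads from `s` to `s'` in exactly `t` steps. -/
def Runs (Φ : ι → (r : ℕ) → (Fin r → ℝ) → ℝ) (p : Prog ι) (s : State) (t : ℕ) (s' : State) :
    Prop :=
  ∀ K, (step Φ)^[t] (p :: K, s) = (K, s')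

theorem Runs.act (a : Instr ι) (s : State) : Runs Φ (.act a) s 1 (a.exec Φ s) := fun _ => rfl

theorem Runs.seq {p q : Prog ι} {s s₁ s₂ : State} {t₁ t₂ : ℕ} (hp : Runs Φ p s t₁ s₁)
    (hq : Runs Φ q s₁ t₂ s₂) : Runs Φ (.seq p q) s (t₂ + (t₁ + 1)) s₂ := fun K => by
  rw [Function.iterate_add_apply, Function.iterate_succ_apply]
  change (step Φ)^[t₂] ((step Φ)^[t₁] (p :: q :: K, s)) = _
  rw [hp, hq]

theorem Runs.loop_false {b : Test} {p : Prog ι} {s : State} (h : ¬ b.Holds s) :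
    Runs Φ (.loop b p) s 1 s := fun K => by
  simp [step, h]

theorem Runs.loop_true {b : Test} {p : Prog ι} {s s₁ s₂ : State} {t₁ t₂ : ℕ} (h : b.Holds s)
    (hp : Runs Φ p s t₁ s₁) (hl : Runs Φ (.loop b p) s₁ t₂ s₂) :
    Runs Φ (.loop b p) s (t₂ + (t₁ + 1)) s₂ := fun K => by
  rw [Function.iterate_add_apply, Function.iterate_succ_apply]
  have : step Φ (.loop b p :: K, s) = (p :: .loop b p :: K, s) := by simp [step, h]
  rw [this, hp, hl]

theorem iterate_step_nil (k : ℕ) (s : State) :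
    (step Φ)^[k] ([], s) = (([] : List (Prog ι)), s) :=
  Function.iterate_fixed rfl k

theorem step_append {L : List (Prog ι)} (hL : L ≠ []) (K : List (Prog ι)) (s : State) :
    step Φ (L ++ K, s) = ((step Φ (L, s)).1 ++ K, (step Φ (L, s)).2) := by
  rcases L with _ | ⟨p, L⟩
  · exact absurd rfl hL
  · cases p with
    | act a => rfl
    | seq p q => rfl
    | ite b p q => by_cases h : b.Holds s <;> simp [step, h]
    | loop b p => by_cases h : b.Holds s <;> simp [step, h]

theorem exists_halt_of_append (K : List (Prog ι)) (k : ℕ) :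
    ∀ (L : List (Prog ι)) (s : State), ((step Φ)^[k] (L ++ K, s)).1 = [] →
      ∃ k', ∃ s', (step Φ)^[k'] (L, s) = ([], s') := by
  induction k with
  | zero =>
    intro L s h
    have : L = [] := (List.append_eq_nil_iff.mp h).1
    exact ⟨0, s, by rw [this]; rfl⟩
  | succ k ih =>
    intro L s h
    by_cases hL : L = []
    · exact ⟨0, s, by rw [hL]; rfl⟩
    · rw [Function.iterate_succ_apply, step_append hL] at h
      obtain ⟨k', s', hk'⟩ := ih _ _ h
      exact ⟨k' + 1, s', hk'⟩

/-- Possibly fewer than `k` steps: a halted configuration idles, but with `K` underneath it would go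
on. -/
theorem exists_iterate_append (K : List (Prog ι)) (k : ℕ) :
    ∀ (L : List (Prog ι)) (s s' : State), (step Φ)^[k] (L, s) = ([], s') →
      ∃ k' ≤ k, (step Φ)^[k'] (L ++ K, s) = (K, s') := by
  induction k with
  | zero =>
    intro L s s' h
    obtain ⟨rfl, rfl⟩ := Prod.mk.inj h
    exact ⟨0, le_rfl, rfl⟩
  | succ k ih =>
    intro L s s' h
    by_cases hL : L = []
    · subst hL
      rw [iterate_step_nil] at h
      obtain ⟨-, rfl⟩ := Prod.mk.inj h
      exact ⟨0, Nat.zero_le _, rfl⟩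
    · rw [Function.iterate_succ_apply] at h
      obtain ⟨k', hk', e⟩ := ih _ _ _ h
      refine ⟨k' + 1, Nat.succ_le_succ hk', ?_⟩
      rw [Function.iterate_succ_apply, step_append hL]
      exact e

theorem Runs.haltsWith {p : Prog ι} {s s' : State} {t : ℕ} (h : Runs Φ p s t s') :
    HaltsWith Φ p s s' := ⟨t, h []⟩

/-- Iterates commute and halted configurations are fixed, so the same `k` also suffices from a later
configuration. -/
theorem iterate_eq_of_halt {x y : List (Prog ι) × State} {m k : ℕ} {s' : State}
    (hxy : (step Φ)^[m] x = y) (hx : (step Φ)^[k] x = ([], s')) : (step Φ)^[k] y = ([], s') := by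
  rw [← hxy, ← Function.iterate_add_apply, add_comm, Function.iterate_add_apply, hx,
    iterate_step_nil]

theorem HaltsWith.unique {p : Prog ι} {s a b : State} (ha : HaltsWith Φ p s a)
    (hb : HaltsWith Φ p s b) : a = b := by
  obtain ⟨k, hk⟩ := ha
  obtain ⟨m, hm⟩ := hb
  have := iterate_eq_of_halt hk hm
  rw [iterate_step_nil] at this
  exact (Prod.mk.inj this).2

/-- A halting run of `p; w; q`, where `p` is known to halt, contains a halting run of `w`. -/
theorem HaltsWith.of_seq_seq {p w q : Prog ι} {s s₁ s' : State} {t : ℕ} (hp : Runs Φ p s t s₁)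
    (h : HaltsWith Φ (.seq p (.seq w q)) s s') :
    ∃ s₂, HaltsWith Φ w s₁ s₂ ∧ HaltsWith Φ q s₂ s' := by
  obtain ⟨k, hk⟩ := h
  have h1 : (step Φ)^[1 + (t + 1)] ([.seq p (.seq w q)], s) = ([w] ++ [q], s₁) := by
    rw [Function.iterate_add_apply, Function.iterate_succ_apply]
    change step Φ ((step Φ)^[t] (p :: [.seq w q], s)) = _
    rw [hp]
    rfl
  have h2 := iterate_eq_of_halt h1 hk
  obtain ⟨k', s₂, hk'⟩ := exists_halt_of_append [q] k [w] s₁ (by rw [h2])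
  obtain ⟨k'', -, hk''⟩ := exists_iterate_append [q] k' [w] s₁ s₂ hk'
  exact ⟨s₂, ⟨k', hk'⟩, ⟨k, iterate_eq_of_halt hk'' h2⟩⟩

theorem runTime_seq_seq_le {p w q : Prog ι} {s s₁ : State} {t T : ℕ} (hp : Runs Φ p s t s₁)
    (hq : ∀ s₂, HaltsWith Φ w s₁ s₂ → ∃ t' ≤ T, ∃ s', Runs Φ q s₂ t' s') :
    runTime Φ (.seq p (.seq w q)) s ≤ ((t + T + 2 : ℕ) : ℝ≥0∞) + runTime Φ w s₁ := by
  -- Moves the constant across so that the infimum defining `runTime Φ W` can be bounded termwise;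
  -- if `w` never halts there is no term and nothing to prove.
  rw [← tsub_le_iff_left]
  refine le_iInf₂ fun k hk => ?_
  rw [tsub_le_iff_left]
  set s₂ := ((step Φ)^[k] ([w], s₁)).2
  have hk2 : (step Φ)^[k] ([w], s₁) = ([], s₂) := Prod.ext hk rfl
  obtain ⟨t', ht', s', hs'⟩ := hq s₂ ⟨k, hk2⟩
  obtain ⟨k', hk', e⟩ := exists_iterate_append [q] k [w] s₁ s₂ hk2
  have h1 : (step Φ)^[t' + (k' + (1 + (t + 1)))] ([.seq p (.seq w q)], s) = ([], s') := by
    rw [Function.iterate_add_apply _ t', Function.iterate_add_apply _ k',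
      Function.iterate_add_apply _ 1, Function.iterate_succ_apply]
    change (step Φ)^[t'] ((step Φ)^[k'] (step Φ ((step Φ)^[t] (p :: [.seq w q], s)))) = _
    rw [hp]
    change (step Φ)^[t'] ((step Φ)^[k'] ([w] ++ [q], s₁)) = _
    rw [e, hs']
  calc runTime Φ (.seq p (.seq w q)) s ≤ ((t' + (k' + (1 + (t + 1))) : ℕ) : ℝ≥0∞) :=
        iInf₂_le _ (by rw [h1])
    _ ≤ ((t + T + 2 + k : ℕ) : ℝ≥0∞) := by
        rw [Nat.cast_le]
        omega
    _ = _ := by push_cast; rfl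

/-- From every state satisfying `P`, the program `p` leads within `T` steps to a state
satisfying `Q`. -/
def Achieves (Φ : ι → (r : ℕ) → (Fin r → ℝ) → ℝ) (P : State → Prop) (p : Prog ι) (T : ℕ)
    (Q : State → Prop) : Prop :=
  ∀ s, P s → ∃ t ≤ T, ∃ s', Runs Φ p s t s' ∧ Q s'

theorem Achieves.seq {P Q R : State → Prop} {p q : Prog ι} {T₁ T₂ : ℕ}
    (hp : Achieves Φ P p T₁ Q) (hq : Achieves Φ Q q T₂ R) :
    Achieves Φ P (.seq p q) (T₁ + T₂ + 1) R := fun s hs => by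
  obtain ⟨t₁, ht₁, s₁, h₁, hs₁⟩ := hp s hs
  obtain ⟨t₂, ht₂, s₂, h₂, hs₂⟩ := hq s₁ hs₁
  exact ⟨_, by omega, s₂, h₁.seq h₂, hs₂⟩

theorem Achieves.mono {P P' Q Q' : State → Prop} {p : Prog ι} {T T' : ℕ}
    (h : Achieves Φ P p T Q) (hP : ∀ s, P' s → P s) (hT : T ≤ T') (hQ : ∀ s, Q s → Q' s) :
    Achieves Φ P' p T' Q' := fun s hs => by
  obtain ⟨t, ht, s', h', hs'⟩ := h s (hP s hs)
  exact ⟨t, ht.trans hT, s', h', hQ s' hs'⟩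

/-- A sequence of elementary instructions. -/
def block : Instr ι → List (Instr ι) → Prog ι
  | a, [] => .act a
  | a, b :: l => .seq (.act a) (block b l)

theorem Achieves.block {P Q : State → Prop} (a : Instr ι) (l : List (Instr ι))
    (h : ∀ s, P s → Q ((a :: l).foldl (fun s a => a.exec Φ s) s)) :
    Achieves Φ P (block a l) (2 * l.length + 1) Q := by
  induction l generalizing a P with
  | nil => exact fun s hs => ⟨1, by simp, _, Runs.act a s, h s hs⟩
  | cons b l ih =>
    have h1 : Achieves Φ P (.act a) 1 fun s' => ∃ s, P s ∧ s' = a.exec Φ s :=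
      fun s hs => ⟨1, le_rfl, _, Runs.act a s, s, hs, rfl⟩
    refine (h1.seq (ih (P := fun s' => ∃ s, P s ∧ s' = a.exec Φ s) b ?_)).mono (fun _ => id) ?_
      (fun _ => id)
    · rintro _ ⟨s, hs, rfl⟩
      exact h s hs
    · simp only [List.length_cons]
      omega

/-- `for r = 0, …, lim - 1 do p`. -/
def forLoop (r lim : ℕ) (p : Prog ι) : Prog ι :=
  .seq (.act (.zero r)) (.loop (.idxLt r lim) p)

/-- The body of a `forLoop` has to increase the loop register itself. -/
theorem Achieves.forLoop {r lim m T : ℕ} {p : Prog ι} {P : State → Prop} {J : ℕ → State → Prop}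
    (h0 : ∀ s, P s → J 0 (s.setIdx r 0))
    (hJ : ∀ k s, J k s → s.idx r = k ∧ s.idx lim = m)
    (hp : ∀ k < m, Achieves Φ (J k) p T (J (k + 1))) :
    Achieves Φ P (forLoop r lim p) (m * (T + 1) + 3) (J m) := by
  have key : ∀ d k, k + d = m →
      Achieves Φ (J k) (.loop (.idxLt r lim) p) (d * (T + 1) + 1) (J m) := by
    intro d
    induction d with
    | zero =>
      intro k hk s hs
      obtain rfl : k = m := hk
      have := hJ k s hs
      exact ⟨1, by simp, s, Runs.loop_false (by simp [Test.Holds, this]), hs⟩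
    | succ d ih =>
      intro k hk s hs
      obtain ⟨t₁, ht₁, s₁, h₁, hs₁⟩ := hp k (by omega) s hs
      obtain ⟨t₂, ht₂, s₂, h₂, hs₂⟩ := ih (k + 1) (by omega) s₁ hs₁
      refine ⟨_, ?_, s₂, Runs.loop_true ?_ h₁ h₂, hs₂⟩
      · rw [Nat.succ_mul]
        omega
      · have := hJ k s hs
        simp only [Test.Holds, this]
        omega
  intro s hs
  obtain ⟨t, ht, s', h', hs'⟩ := key m 0 (by omega) _ (h0 s hs)
  exact ⟨_, by omega, s', (Runs.act (.zero r) s).seq h', hs'⟩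

end Semantics

/-! ### Running a deterministic program in a relocated part of the memory -/

section Shift

variable {ι : Type*} {Φ : ι → (r : ℕ) → (Fin r → ℝ) → ℝ}

/-- Rename the registers and arrays of a program by adding `d` to their numbers. -/
def Cell.shift (d : ℕ) (c : Cell) : Cell := ⟨c.arr + d, c.row + d, c.col + d⟩

def Instr.shift (d : ℕ) : Instr ι → Instr ι
  | .zero r => .zero (r + d)
  | .succ r => .succ (r + d)
  | .pred r => .pred (r + d)
  | .copy dst r => .copy (dst + d) (r + d)
  | .one dst => .one (dst.shift d)
  | .add dst a b => .add (dst.shift d) (a.shift d) (b.shift d)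
  | .sub dst a b => .sub (dst.shift d) (a.shift d) (b.shift d)
  | .mul dst a b => .mul (dst.shift d) (a.shift d) (b.shift d)
  | .div dst a b => .div (dst.shift d) (a.shift d) (b.shift d)
  | .prim o dst arr row len => .prim o (dst.shift d) (arr + d) (row + d) (len + d)
  | .rand dst => .rand (dst.shift d)

def Test.shift (d : ℕ) : Test → Test
  | .idxLt r r' => .idxLt (r + d) (r' + d)
  | .realLe a b => .realLe (a.shift d) (b.shift d)

def Prog.shift (d : ℕ) : Prog ι → Prog ι
  | .act a => .act (a.shift d)
  | .seq p q => .seq (p.shift d) (q.shift d)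
  | .ite b p q => .ite (b.shift d) (p.shift d) (q.shift d)
  | .loop b p => .loop (b.shift d) (p.shift d)

/-- The state `s'` is `s₀`, except that the registers and arrays with numbers from `d` on hold
the contents of `s`. -/
structure Embeds (d : ℕ) (s₀ s s' : State) : Prop where
  idx : ∀ r, s'.idx (r + d) = s.idx r
  mem : ∀ a i j, s'.mem (a + d) i j = s.mem a i j
  idx_low : ∀ r < d, s'.idx r = s₀.idx r
  mem_low : ∀ a < d, s'.mem a = s₀.mem a

namespace Embeds

variable {d : ℕ} {s₀ s s' : State}

theorem read (h : Embeds d s₀ s s') (c : Cell) : s'.read (c.shift d) = s.read c := by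
  simp [State.read, Cell.shift, h.idx, h.mem]

theorem setIdx (h : Embeds d s₀ s s') (r k : ℕ) :
    Embeds d s₀ (s.setIdx r k) (s'.setIdx (r + d) k) where
  idx q := by
    by_cases hq : q = r <;> simp [State.setIdx, hq, h.idx]
  mem := h.mem
  idx_low q hq := by
    have : q ≠ r + d := by omega
    simp [State.setIdx, this, h.idx_low q hq]
  mem_low := h.mem_low

theorem write (h : Embeds d s₀ s s') (c : Cell) (v : ℝ) :
    Embeds d s₀ (s.write c v) (s'.write (c.shift d) v) where
  idx := h.idx
  mem a i j := by simp [State.write, Cell.shift, h.idx, h.mem]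
  idx_low := h.idx_low
  mem_low a ha := by
    have : a ≠ c.arr + d := by omega
    simp [State.write, Cell.shift, this, h.mem_low a ha]

theorem holds_iff (h : Embeds d s₀ s s') (b : Test) : (b.shift d).Holds s' ↔ b.Holds s := by
  cases b with
  | idxLt r r' => simp [Test.shift, Test.Holds, h.idx]
  | realLe a b => simp [Test.shift, Test.Holds, h.read]

theorem exec (h : Embeds d s₀ s s') (a : Instr ι) (ha : (Prog.act a).Deterministic) :
    Embeds d s₀ (a.exec Φ s) ((a.shift d).exec Φ s') := by
  cases a with
  | zero r => exact h.setIdx r 0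
  | succ r => simpa [Instr.exec, Instr.shift, h.idx] using h.setIdx r (s.idx r + 1)
  | pred r => simpa [Instr.exec, Instr.shift, h.idx] using h.setIdx r (s.idx r - 1)
  | copy q r => simpa [Instr.exec, Instr.shift, h.idx] using h.setIdx q (s.idx r)
  | one c => exact h.write c 1
  | add c a b => simpa [Instr.exec, Instr.shift, h.read] using h.write c (s.read a + s.read b)
  | sub c a b => simpa [Instr.exec, Instr.shift, h.read] using h.write c (s.read a - s.read b)
  | mul c a b => simpa [Instr.exec, Instr.shift, h.read] using h.write c (s.read a * s.read b)
  | div c a b => simpa [Instr.exec, Instr.shift, h.read] using h.write c (s.read a / s.read b)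
  | prim o c arr row len =>
    have := h.write c (Φ o (s.idx len) (fun k => s.mem arr (s.idx row) k))
    simp only [Instr.exec, Instr.shift, h.mem]
    rw [h.idx, h.idx]
    exact this
  | rand c => exact absurd ha id

/-- Lockstep simulation. `Embeds` does not compare the random streams, which is why the programs
must be deterministic. -/
theorem iterate_step (k : ℕ) : ∀ (L : List (Prog ι)) (s s' : State), Embeds d s₀ s s' →
    (∀ p ∈ L, p.Deterministic) →
    ((step Φ)^[k] (L.map (Prog.shift d), s')).1 =
        ((step Φ)^[k] (L, s)).1.map (Prog.shift d) ∧
      Embeds d s₀ ((step Φ)^[k] (L, s)).2 ((step Φ)^[k] (L.map (Prog.shift d), s')).2 := by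
  induction k with
  | zero => exact fun L s s' h _ => ⟨rfl, h⟩
  | succ k ih =>
    intro L s s' h hL
    rw [Function.iterate_succ_apply, Function.iterate_succ_apply]
    rcases L with _ | ⟨p, L⟩
    · exact ih [] s s' h hL
    have hLL : ∀ q ∈ L, q.Deterministic := fun q hq => hL q (List.mem_cons_of_mem _ hq)
    have hp := hL p List.mem_cons_self
    cases p with
    | act a => exact ih L _ _ (h.exec a hp) hLL
    | seq p q =>
      refine ih (p :: q :: L) s s' h fun x hx => ?_
      rcases List.mem_cons.mp hx with rfl | hx
      · exact hp.1
      rcases List.mem_cons.mp hx with rfl | hx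
      · exact hp.2
      · exact hLL x hx
    | ite b p q =>
      have hdet : ∀ y, y.Deterministic → ∀ x ∈ y :: L, x.Deterministic := fun y hy x hx => by
        rcases List.mem_cons.mp hx with rfl | hx
        · exact hy
        · exact hLL x hx
      by_cases hb : b.Holds s
      · have hb' := (h.holds_iff b).mpr hb
        simpa [step, Prog.shift, hb, hb'] using ih (p :: L) s s' h (hdet p hp.1)
      · have hb' := mt (h.holds_iff b).mp hb
        simpa [step, Prog.shift, hb, hb'] using ih (q :: L) s s' h (hdet q hp.2)
    | loop b p =>
      by_cases hb : b.Holds s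
      · have hb' := (h.holds_iff b).mpr hb
        have := ih (p :: .loop b p :: L) s s' h fun x hx => by
          rcases List.mem_cons.mp hx with rfl | hx
          · exact hp
          · exact hL x hx
        simpa [step, Prog.shift, hb, hb'] using this
      · have hb' := mt (h.holds_iff b).mp hb
        simpa [step, Prog.shift, hb, hb'] using ih L s s' h hLL

theorem runTime_shift (h : Embeds d s₀ s s') {w : Prog ι} (hw : w.Deterministic) :
    runTime Φ (w.shift d) s' = runTime Φ w s := by
  have key : ∀ k, ((step Φ)^[k] ([w.shift d], s')).1 = [] ↔ ((step Φ)^[k] ([w], s)).1 = [] := by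
    intro k
    have := (iterate_step (Φ := Φ) k [w] s s' h (by simpa using hw)).1
    simp only [List.map_cons, List.map_nil] at this
    rw [this, List.map_eq_nil_iff]
  simp only [runTime, key]

theorem exists_haltsWith (h : Embeds d s₀ s s') {w : Prog ι} (hw : w.Deterministic) {t' : State}
    (ht' : HaltsWith Φ (w.shift d) s' t') : ∃ t, HaltsWith Φ w s t ∧ Embeds d s₀ t t' := by
  obtain ⟨k, hk⟩ := ht'
  have := iterate_step (Φ := Φ) k [w] s s' h (by simpa using hw)
  simp only [List.map_cons, List.map_nil, hk] at this
  exact ⟨_, ⟨k, Prod.ext (List.map_eq_nil_iff.mp this.1.symm) rfl⟩, this.2⟩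

end Embeds

end Shift

/-! ### Measurability of the running time in the initial memory -/

section Measurability

variable {ι : Type*} {Φ : ι → (r : ℕ) → (Fin r → ℝ) → ℝ} {α : Type*} [MeasurableSpace α]

/-- Handles indirect addressing: the cell accessed depends on the parameter, but ranges over
countably many. -/
theorem measurable_apply_nat {β : Type*} [MeasurableSpace β] {f : α → ℕ} {g : ℕ → α → β}
    (hf : Measurable f) (hg : ∀ k, Measurable (g k)) : Measurable fun a => g (f a) a :=
  (measurable_from_prod_countable_right (f := fun x : ℕ × α => g x.1 x.2) hg).comp
    (hf.prodMk measurable_id)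

/-- A state that depends measurably on a parameter. -/
structure MeasurableState (s : α → State) : Prop where
  idx : ∀ r, Measurable fun a => (s a).idx r
  mem : ∀ b i j, Measurable fun a => (s a).mem b i j
  seed : ∀ k, Measurable fun a => (s a).seed k

namespace MeasurableState

variable {s : α → State}

theorem read (h : MeasurableState s) (c : Cell) : Measurable fun a => (s a).read c :=
  measurable_apply_nat (g := fun i a => (s a).mem c.arr i ((s a).idx c.col)) (h.idx _) fun i =>
    measurable_apply_nat (g := fun j a => (s a).mem c.arr i j) (h.idx _) fun j => h.mem _ i j

theorem setIdx (h : MeasurableState s) (r : ℕ) {f : α → ℕ} (hf : Measurable f) :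
    MeasurableState fun a => (s a).setIdx r (f a) where
  idx q := by
    by_cases hq : q = r
    · simpa [State.setIdx, Function.update_apply, hq] using hf
    · simpa [State.setIdx, Function.update_apply, hq] using h.idx q
  mem := h.mem
  seed := h.seed

theorem write (h : MeasurableState s) (c : Cell) {f : α → ℝ} (hf : Measurable f) :
    MeasurableState fun a => (s a).write c (f a) where
  idx := h.idx
  mem b i j := by
    refine Measurable.ite ?_ hf (h.mem b i j)
    exact (MeasurableSet.const _).inter
      ((measurableSet_eq_fun measurable_const (h.idx _)).inter
        (measurableSet_eq_fun measurable_const (h.idx _)))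
  seed := h.seed

theorem exec (hΦ : ∀ o r, Measurable (Φ o r)) (h : MeasurableState s) (a : Instr ι) :
    MeasurableState fun x => a.exec Φ (s x) := by
  cases a with
  | zero r => exact h.setIdx r measurable_const
  | succ r => exact h.setIdx r ((h.idx r).add_const 1)
  | pred r => exact h.setIdx r ((Measurable.of_discrete (f := fun k : ℕ => k - 1)).comp (h.idx r))
  | copy q r => exact h.setIdx q (h.idx r)
  | one c => exact h.write c measurable_const
  | add c a b => exact h.write c ((h.read a).add (h.read b))
  | sub c a b => exact h.write c ((h.read a).sub (h.read b))
  | mul c a b => exact h.write c ((h.read a).mul (h.read b))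
  | div c a b => exact h.write c ((h.read a).div (h.read b))
  | prim o c arr row len =>
    refine h.write c (measurable_apply_nat
      (g := fun m x => Φ o m fun k => (s x).mem arr ((s x).idx row) k) (h.idx len) fun m => ?_)
    refine (hΦ o m).comp (measurable_pi_lambda _ fun k => ?_)
    exact measurable_apply_nat (g := fun i x => (s x).mem arr i k) (h.idx row) fun i =>
      h.mem arr i k
  | rand c =>
    have h1 := h.write c (h.seed 0)
    exact ⟨h1.idx, h1.mem, fun k => h.seed (k + 1)⟩

theorem measurableSet_holds (h : MeasurableState s) (b : Test) :
    MeasurableSet {x | b.Holds (s x)} := by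
  cases b with
  | idxLt r r' => exact measurableSet_lt (h.idx r) (h.idx r')
  | realLe a b => exact measurableSet_le (h.read a) (h.read b)

/-- Each test splits the parameter space into two measurable pieces, on which the control stack is
the same for all parameters. -/
theorem measurableSet_halted (hΦ : ∀ o r, Measurable (Φ o r)) (k : ℕ) :
    ∀ (L : List (Prog ι)) (s : α → State), MeasurableState s →
      MeasurableSet {x | ((step Φ)^[k] (L, s x)).1 = []} := by
  induction k with
  | zero => exact fun L s _ => MeasurableSet.const (L = [])
  | succ k ih =>
    intro L s h
    simp only [Function.iterate_succ_apply]
    rcases L with _ | ⟨p, L⟩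
    · exact ih [] s h
    have hite : ∀ (b : Test) (K K' : List (Prog ι)),
        MeasurableSet {x | ((step Φ)^[k] (open Classical in
          if b.Holds (s x) then (K, s x) else (K', s x))).1 = []} := by
      intro b K K'
      classical
      have : {x | ((step Φ)^[k] (if b.Holds (s x) then (K, s x) else (K', s x))).1 = []} =
          ({x | b.Holds (s x)} ∩ {x | ((step Φ)^[k] (K, s x)).1 = []}) ∪
          ({x | b.Holds (s x)}ᶜ ∩ {x | ((step Φ)^[k] (K', s x)).1 = []}) := by
        ext x
        by_cases hx : b.Holds (s x) <;> simp [hx]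
      have hb := h.measurableSet_holds b
      convert (hb.inter (ih K s h)).union (hb.compl.inter (ih K' s h)) using 1
    cases p with
    | act a => exact ih L _ (h.exec hΦ a)
    | seq p q => exact ih (p :: q :: L) s h
    | ite b p q => exact hite b _ _
    | loop b p => exact hite b _ _

theorem measurable_runTime (hΦ : ∀ o r, Measurable (Φ o r)) (h : MeasurableState s)
    (p : Prog ι) : Measurable fun x => runTime Φ p (s x) := by
  classical
  refine Measurable.iInf fun k => ?_
  have : (fun x => ⨅ (_ : ((step Φ)^[k] ([p], s x)).1 = []), (k : ℝ≥0∞)) =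
      fun x => if ((step Φ)^[k] ([p], s x)).1 = [] then (k : ℝ≥0∞) else ⊤ := by
    funext x
    split_ifs with hx <;> simp [hx]
  rw [this]
  exact Measurable.ite (measurableSet_halted hΦ k [p] s h) measurable_const measurable_const

end MeasurableState

end Measurability

end RealRAM

/-! ### The law of the noise -/

namespace RealRAM

open MeasureTheory ProbabilityTheory

instance : IsProbabilityMeasure seedLaw := by
  unfold seedLaw
  infer_instance

theorem map_affine_unitInterval {σ : ℝ} (hσ : 0 < σ) :
    (volume : Measure unitInterval).map (fun x : unitInterval => σ * (2 * (x : ℝ) - 1)) =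
      ProbabilityTheory.cond volume (Set.Icc (-σ) σ) := by
  have hg : Measurable fun x : ℝ => σ * (2 * x - 1) := by fun_prop
  have h1 : (volume : Measure unitInterval).map (fun x : unitInterval => σ * (2 * (x : ℝ) - 1)) =
      ((volume : Measure ℝ).restrict (Set.Icc 0 1)).map (fun x : ℝ => σ * (2 * x - 1)) := by
    rw [← unitInterval.measurePreserving_coe.map_eq, Measure.map_map hg measurable_subtype_coe]
    rfl
  have hpre : (fun x : ℝ => σ * (2 * x - 1)) ⁻¹' Set.Icc (-σ) σ = Set.Icc 0 1 := by
    ext x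
    simp only [Set.mem_preimage, Set.mem_Icc]
    constructor
    · rintro ⟨h1, h2⟩
      constructor <;> nlinarith
    · rintro ⟨h1, h2⟩
      constructor <;> nlinarith
  have hmap : (volume : Measure ℝ).map (fun x : ℝ => σ * (2 * x - 1)) =
      ENNReal.ofReal (2 * σ)⁻¹ • volume := by
    have : (fun x : ℝ => σ * (2 * x - 1)) = (fun x => -σ + x) ∘ fun x => 2 * σ * x := by
      funext x
      simp only [Function.comp]
      ring
    rw [this, ← Measure.map_map (by fun_prop) (by fun_prop), Real.map_volume_mul_left (by positivity),
      Measure.map_smul, map_add_left_eq_self, abs_of_pos (by positivity)]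
  rw [h1, ← hpre, ← Measure.restrict_map hg measurableSet_Icc, hmap, Measure.restrict_smul,
    ProbabilityTheory.cond, Real.volume_Icc, ENNReal.ofReal_inv_of_pos (by positivity)]
  congr 3
  ring

/-- The noise matrices that the random numbers `ω` determine, when the entries are drawn in the
order `f`. -/
def noise {κ : Type*} (σ : ℝ) (f : κ ⊕ κ → ℕ) (ω : ℕ → unitInterval) : (κ → ℝ) × (κ → ℝ) :=
  (fun q => σ * (2 * (ω (f (.inl q)) : ℝ) - 1), fun q => σ * (2 * (ω (f (.inr q)) : ℝ) - 1))

theorem measurable_noise {κ : Type*} (σ : ℝ) (f : κ ⊕ κ → ℕ) : Measurable (noise σ f) := by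
  unfold noise
  fun_prop

theorem noise_mem {κ : Type*} {σ : ℝ} (hσ : 0 < σ) (f : κ ⊕ κ → ℕ) (ω : ℕ → unitInterval)
    (q : κ) : (noise σ f ω).1 q ∈ Set.Icc (-σ) σ ∧ (noise σ f ω).2 q ∈ Set.Icc (-σ) σ := by
  have key : ∀ x : unitInterval, σ * (2 * (x : ℝ) - 1) ∈ Set.Icc (-σ) σ := fun x => by
    have h0 := x.2.1
    have h1 := x.2.2
    constructor <;> nlinarith
  exact ⟨key _, key _⟩

/-- Distinct positions of the stream are independent, so injectivity of `f` makes the joint law a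
product; the sum index type is then split into two factors. -/
theorem map_noise {n : ℕ} {σ : ℝ} (hσ : 0 < σ) {f : (Fin n × Fin n) ⊕ (Fin n × Fin n) → ℕ}
    (hf : Function.Injective f) :
    seedLaw.map (noise σ f) = (Leontief.uniformNoise n σ).prod (Leontief.uniformNoise n σ) := by
  set Y : (Fin n × Fin n) ⊕ (Fin n × Fin n) → (ℕ → unitInterval) → ℝ :=
    fun q ω => σ * (2 * (ω (f q) : ℝ) - 1) with hY
  have hYm : ∀ q, Measurable (Y q) := fun q => by fun_prop
  have hind : iIndepFun Y seedLaw :=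
    (iIndepFun_infinitePi (P := fun _ : ℕ => (volume : Measure unitInterval))
      (X := fun _ x => σ * (2 * (x : ℝ) - 1)) (fun _ => by fun_prop)).precomp hf
  have hlaw : ∀ q, seedLaw.map (Y q) = ProbabilityTheory.cond volume (Set.Icc (-σ) σ) := by
    intro q
    have hg : Measurable fun x : unitInterval => σ * (2 * (x : ℝ) - 1) := by fun_prop
    rw [← map_affine_unitInterval hσ, ← Measure.infinitePi_map_eval
      (fun _ : ℕ => (volume : Measure unitInterval)) (f q),
      Measure.map_map hg (measurable_pi_apply (X := fun _ : ℕ => unitInterval) (f q))]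
    rfl
  have hpi := (iIndepFun_iff_map_fun_eq_pi_map fun q => (hYm q).aemeasurable).mp hind
  simp only [hlaw] at hpi
  have : IsProbabilityMeasure (ProbabilityTheory.cond volume (Set.Icc (-σ) σ) : Measure ℝ) := by
    rw [← map_affine_unitInterval hσ]
    exact Measure.isProbabilityMeasure_map (by fun_prop)
  have hprod := (measurePreserving_sumPiEquivProdPi
    (X := fun _ : (Fin n × Fin n) ⊕ (Fin n × Fin n) => ℝ)
    (fun _ => (ProbabilityTheory.cond volume (Set.Icc (-σ) σ) : Measure ℝ))).map_eq
  rw [← hpi, Measure.map_map (MeasurableEquiv.measurable _) (measurable_pi_lambda _ hYm)] at hprod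
  exact hprod

end RealRAM

/-! ### The reduction as a program -/

namespace RealRAM

theorem State.write_idx (s : State) (c : Cell) (v : ℝ) : (s.write c v).idx = s.idx := rfl

theorem State.write_seed (s : State) (c : Cell) (v : ℝ) : (s.write c v).seed = s.seed := rfl

theorem State.write_mem (s : State) (c : Cell) (v : ℝ) (a i j : ℕ) :
    (s.write c v).mem a i j =
      if a = c.arr ∧ i = s.idx c.row ∧ j = s.idx c.col then v else s.mem a i j := rfl

theorem State.setIdx_idx (s : State) (r k q : ℕ) :
    (s.setIdx r k).idx q = if q = r then k else s.idx q := by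
  simp [State.setIdx, Function.update_apply]

theorem State.setIdx_seed (s : State) (r k : ℕ) : (s.setIdx r k).seed = s.seed := rfl

theorem State.setIdx_mem (s : State) (r k : ℕ) : (s.setIdx r k).mem = s.mem := rfl

end RealRAM

namespace GameReduction

open RealRAM

variable {ι : Type*} {Φ : ι → (r : ℕ) → (Fin r → ℝ) → ℝ}

/-- The cell `[0, 0]` of an array; register `2` always holds `0`. -/
def scalar (a : ℕ) : Cell := ⟨a, 2, 2⟩

/-- Registers `1` and `16` receive `2 n`, the scalar `6` receives `n`. -/
def countProg : Prog ι :=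
  forLoop 3 0 (block (.succ 1) [.succ 1, .succ 16, .succ 16,
    .add (scalar 6) (scalar 6) (scalar 5), .succ 3])

/-- The constants `1`, `1 / 2` and `σ = ε / (512 n)` in the scalars `5`, `8` and `7`. -/
def constProg : Prog ι :=
  .seq (block (.one (scalar 5)) [.add (scalar 8) (scalar 5) (scalar 5),
    .div (scalar 8) (scalar 5) (scalar 8)])
  (.seq countProg
    -- Nine doublings turn `n` into `512 n`.
    (block (.add (scalar 6) (scalar 6) (scalar 6)) [.add (scalar 6) (scalar 6) (scalar 6),
      .add (scalar 6) (scalar 6) (scalar 6), .add (scalar 6) (scalar 6) (scalar 6),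
      .add (scalar 6) (scalar 6) (scalar 6), .add (scalar 6) (scalar 6) (scalar 6),
      .add (scalar 6) (scalar 6) (scalar 6), .add (scalar 6) (scalar 6) (scalar 6),
      .add (scalar 6) (scalar 6) (scalar 6), .div (scalar 7) (scalar 2) (scalar 6)]))

/-- Half the identity matrix in array `16`. -/
def diagProg : Prog ι :=
  forLoop 3 1 (block (.mul ⟨16, 3, 3⟩ (scalar 8) (scalar 5)) [.succ 3])

/-- Half the payoff matrices in the off-diagonal blocks of array `17`. -/
def payoffProg : Prog ι :=
  forLoop 3 0 (.seq (.act (.copy 6 0)) (.seq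
    (forLoop 4 0 (block (.mul ⟨17, 3, 6⟩ ⟨0, 3, 4⟩ (scalar 8))
      [.mul ⟨17, 6, 3⟩ ⟨1, 3, 4⟩ (scalar 8), .succ 4, .succ 6]))
    (.act (.succ 3))))

/-- Add noise in `[σ, 3 σ]` to all entries of the arrays `16` and `17`. -/
def noiseProg : Prog ι :=
  forLoop 3 1 (.seq
    (forLoop 4 1 (block (.rand (scalar 9)) [.add (scalar 9) (scalar 9) (scalar 9),
      .add (scalar 9) (scalar 9) (scalar 5), .mul (scalar 9) (scalar 9) (scalar 7),
      .add ⟨16, 3, 4⟩ ⟨16, 3, 4⟩ (scalar 9), .rand (scalar 9),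
      .add (scalar 9) (scalar 9) (scalar 9), .add (scalar 9) (scalar 9) (scalar 5),
      .mul (scalar 9) (scalar 9) (scalar 7), .add ⟨17, 3, 4⟩ ⟨17, 3, 4⟩ (scalar 9), .succ 4]))
    (.act (.succ 3)))

/-- Write the perturbed economy of the game into the arrays `16` and `17`. -/
def setupProg : Prog ι := .seq constProg (.seq diagProg (.seq payoffProg noiseProg))

/-- The sums of the two halves of row `0` of array `18`. -/
def sumProg : Prog ι :=
  .seq (block (.sub (scalar 10) (scalar 10) (scalar 10))
    [.sub (scalar 11) (scalar 11) (scalar 11), .copy 6 0])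
  (forLoop 4 0 (block (.add (scalar 10) (scalar 10) ⟨18, 2, 4⟩)
    [.add (scalar 11) (scalar 11) ⟨18, 2, 6⟩, .succ 4, .succ 6]))

/-- Normalise the two halves of row `0` of array `18` into the arrays `3` and `4`. -/
def normalizeProg : Prog ι :=
  .seq sumProg (.seq (.act (.copy 6 0))
    (forLoop 4 0 (block (.div ⟨3, 2, 4⟩ ⟨18, 2, 4⟩ (scalar 10))
      [.div ⟨4, 2, 4⟩ ⟨18, 2, 6⟩ (scalar 11), .succ 4, .succ 6])))

/-- Solve a bimatrix game by solving a random Leontief economy with the program `W`. -/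
def gameProg (W : Prog ι) : Prog ι := .seq setupProg (.seq (W.shift 16) normalizeProg)

/-- The memory during the setup phase, with the contents `e` and `d` of the arrays `16` and `17`
and the remaining random numbers `w`. -/
structure Setup (n : ℕ) (α β : ℕ → ℕ → ℝ) (σ : ℝ) (e d : ℕ → ℕ → ℝ) (w : ℕ → ℝ) (s : State) :
    Prop where
  idx0 : s.idx 0 = n
  idx1 : s.idx 1 = n + n
  idx2 : s.idx 2 = 0
  idx16 : s.idx 16 = n + n
  idx17 : ∀ r, s.idx (r + 17) = 0
  mem0 : ∀ i j, s.mem 0 i j = α i j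
  mem1 : ∀ i j, s.mem 1 i j = β i j
  mem5 : s.mem 5 0 0 = 1
  mem7 : s.mem 7 0 0 = σ
  mem8 : s.mem 8 0 0 = 1 / 2
  mem16 : ∀ i j, s.mem 16 i j = e i j
  mem17 : ∀ i j, s.mem 17 i j = d i j
  mem18 : ∀ a i j, s.mem (a + 18) i j = 0
  seed : ∀ k, s.seed k = w k

/-- The initial memory. -/
structure Init (n : ℕ) (α β : ℕ → ℕ → ℝ) (ε : ℝ) (w : ℕ → ℝ) (s : State) : Prop where
  idx0 : s.idx 0 = n
  idx : ∀ r, s.idx (r + 1) = 0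
  mem0 : ∀ i j, s.mem 0 i j = α i j
  mem1 : ∀ i j, s.mem 1 i j = β i j
  mem2 : s.mem 2 0 0 = ε
  mem : ∀ a i j, s.mem (a + 3) i j = 0
  seed : ∀ k, s.seed k = w k

/-- The memory while `countProg` runs. -/
structure Count (n : ℕ) (α β : ℕ → ℕ → ℝ) (ε : ℝ) (w : ℕ → ℝ) (k : ℕ) (s : State) : Prop where
  idx0 : s.idx 0 = n
  idx1 : s.idx 1 = k + k
  idx2 : s.idx 2 = 0
  idx3 : s.idx 3 = k
  idx16 : s.idx 16 = k + k
  idx17 : ∀ r, s.idx (r + 17) = 0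
  mem0 : ∀ i j, s.mem 0 i j = α i j
  mem1 : ∀ i j, s.mem 1 i j = β i j
  mem2 : s.mem 2 0 0 = ε
  mem5 : s.mem 5 0 0 = 1
  mem6 : s.mem 6 0 0 = k
  mem8 : s.mem 8 0 0 = 1 / 2
  mem16 : ∀ a i j, s.mem (a + 16) i j = 0
  seed : ∀ k, s.seed k = w k

variable {n : ℕ} {α β : ℕ → ℕ → ℝ} {ε σ : ℝ} {w : ℕ → ℝ}

theorem achieves_countProg :
    Achieves Φ (Count n α β ε w 0) countProg (n * 12 + 3) (Count n α β ε w n) := by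
  refine Achieves.forLoop (T := 11) (m := n) (J := fun k => Count n α β ε w k) ?_
    (fun k s h => ⟨h.idx3, h.idx0⟩) (fun k _ => ?_)
  · intro s h
    constructor <;> simp [State.setIdx_idx, State.setIdx_mem, State.setIdx_seed, h.idx0, h.idx1,
      h.idx2, h.idx16, h.idx17, h.mem0, h.mem1, h.mem2, h.mem5, h.mem6, h.mem8, h.mem16, h.seed]
  · refine Achieves.block _ _ fun s h => ?_
    constructor <;> simp [scalar, Instr.exec, State.read, State.write_idx, State.write_mem,
      State.write_seed, State.setIdx_idx, State.setIdx_mem, State.setIdx_seed, h.idx0, h.idx1,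
      h.idx2, h.idx3, h.idx16, h.idx17, h.mem0, h.mem1, h.mem2, h.mem5, h.mem6, h.mem8, h.mem16,
      h.seed]
    all_goals omega

theorem achieves_constProg :
    Achieves Φ (Init n α β ε w) constProg (n * 12 + 29)
      (Setup n α β (ε / (512 * n)) (fun _ _ => 0) (fun _ _ => 0) w) := by
  have h1 : Achieves Φ (Init n α β ε w) (block (.one (scalar 5))
      [.add (scalar 8) (scalar 5) (scalar 5), .div (scalar 8) (scalar 5) (scalar 8)]) 5
      (Count n α β ε w 0) := by
    refine Achieves.block _ _ fun s h => ?_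
    have hm : ∀ a, 3 ≤ a → ∀ i j, s.mem a i j = 0 := fun a ha i j => by
      obtain ⟨b, rfl⟩ := Nat.exists_eq_add_of_le' ha
      exact h.mem b i j
    have hi : ∀ r, 1 ≤ r → s.idx r = 0 := fun r hr => by
      obtain ⟨b, rfl⟩ := Nat.exists_eq_add_of_le' hr
      exact h.idx b
    constructor <;> simp [scalar, Instr.exec, State.read, State.write_idx, State.write_mem,
      State.write_seed, h.idx0, hi, h.mem0, h.mem1, h.mem2, hm, h.seed]
    norm_num
  have h2 : Achieves Φ (Count n α β ε w n) (block (.add (scalar 6) (scalar 6) (scalar 6))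
      [.add (scalar 6) (scalar 6) (scalar 6),
      .add (scalar 6) (scalar 6) (scalar 6), .add (scalar 6) (scalar 6) (scalar 6),
      .add (scalar 6) (scalar 6) (scalar 6), .add (scalar 6) (scalar 6) (scalar 6),
      .add (scalar 6) (scalar 6) (scalar 6), .add (scalar 6) (scalar 6) (scalar 6),
      .add (scalar 6) (scalar 6) (scalar 6), .div (scalar 7) (scalar 2) (scalar 6)]) 19
      (Setup n α β (ε / (512 * n)) (fun _ _ => 0) (fun _ _ => 0) w) := by
    refine Achieves.block _ _ fun s h => ?_
    have h16 := h.mem16 0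
    have h17 := h.mem16 1
    have h18 := fun a => h.mem16 (a + 2)
    simp only [zero_add, Nat.reduceAdd, add_assoc] at h16 h17 h18
    constructor <;> simp [scalar, Instr.exec, State.read, State.write_idx, State.write_mem,
      State.write_seed, h.idx0, h.idx1, h.idx2, h.idx16, h.idx17, h.mem0, h.mem1, h.mem2, h.mem5,
      h.mem6, h.mem8, h16, h17, h18, h.seed]
    congr 1
    ring
  exact (h1.seq (achieves_countProg.seq h2)).mono (fun _ => id) (by omega) (fun _ => id)

theorem Setup.setIdx {e d : ℕ → ℕ → ℝ} {s : State} (h : Setup n α β σ e d w s) {r : ℕ}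
    (hr : 2 < r) (hr' : r < 16) (k : ℕ) : Setup n α β σ e d w (s.setIdx r k) := by
  have hne : ∀ q, q ≤ 2 ∨ 16 ≤ q → (s.setIdx r k).idx q = s.idx q := fun q hq => by
    rw [State.setIdx_idx, if_neg (by omega)]
  exact { h with
    idx0 := by rw [hne _ (by omega), h.idx0]
    idx1 := by rw [hne _ (by omega), h.idx1]
    idx2 := by rw [hne _ (by omega), h.idx2]
    idx16 := by rw [hne _ (by omega), h.idx16]
    idx17 := fun q => by rw [hne _ (by omega), h.idx17] }

theorem Setup.congr {e d e' d' : ℕ → ℕ → ℝ} {w' : ℕ → ℝ} {s : State}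
    (h : Setup n α β σ e d w s) (he : ∀ i j, e i j = e' i j) (hd : ∀ i j, d i j = d' i j)
    (hw : ∀ k, w k = w' k) : Setup n α β σ e' d' w' s :=
  { h with
    mem16 := fun i j => (h.mem16 i j).trans (he i j)
    mem17 := fun i j => (h.mem17 i j).trans (hd i j)
    seed := fun k => (h.seed k).trans (hw k) }

/-- The endowments before perturbation. -/
def endowBase (n : ℕ) (i j : ℕ) : ℝ := if i = j ∧ i < n + n then 1 / 2 else 0

/-- The demands before perturbation. -/
def demandBase (n : ℕ) (α β : ℕ → ℕ → ℝ) (i j : ℕ) : ℝ :=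
  if i < n ∧ n ≤ j then α i (j - n) / 2 else if j < n ∧ n ≤ i then β j (i - n) / 2 else 0

theorem achieves_diagProg {d : ℕ → ℕ → ℝ} :
    Achieves Φ (Setup n α β σ (fun _ _ => 0) d w) diagProg ((n + n) * 4 + 3)
      (Setup n α β σ (endowBase n) d w) := by
  refine (Achieves.forLoop (T := 3) (m := n + n) (P := Setup n α β σ (fun _ _ => 0) d w)
    (J := fun k s => Setup n α β σ (fun i j => if i = j ∧ i < k then 1 / 2 else 0) d w s ∧
      s.idx 3 = k) ?_ (fun k s h => ⟨h.2, h.1.idx1⟩) (fun k _ => ?_)).mono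
      (fun _ => id) le_rfl (fun s h => h.1)
  · intro s h
    refine ⟨(h.setIdx (by norm_num) (by norm_num) 0).congr (by simp) (fun _ _ => rfl)
      fun _ => rfl, by simp [State.setIdx_idx]⟩
  · refine Achieves.block _ _ fun s h => ?_
    obtain ⟨h, h3⟩ := h
    refine ⟨?_, by simp [scalar, Instr.exec, State.setIdx_idx, State.write_idx, h3]⟩
    constructor
    case mem16 =>
      intro i j
      simp [scalar, Instr.exec, State.read, State.write_idx, State.write_mem,
        State.setIdx_mem, h3, h.mem5, h.mem8, h.idx2, h.mem16]
      grind
    all_goals simp [scalar, Instr.exec, State.read, State.write_idx, State.write_mem,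
      State.write_seed, State.setIdx_idx, State.setIdx_mem, State.setIdx_seed, h.idx0, h.idx1,
      h.idx2, h3, h.idx16, h.idx17, h.mem0, h.mem1, h.mem5, h.mem7, h.mem8, h.mem17, h.mem18,
      h.seed]

/-- The demands before perturbation after `i` full rounds and `k` inner rounds of
`payoffProg`. -/
def demandPart (n : ℕ) (α β : ℕ → ℕ → ℝ) (i k a b : ℕ) : ℝ :=
  if n ≤ b ∧ (a < i ∨ a = i ∧ b < n + k) then α a (b - n) / 2
  else if n ≤ a ∧ (b < i ∨ b = i ∧ a < n + k) then β b (a - n) / 2 else 0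

theorem demandPart_succ {i k a b : ℕ} (hi : i < n) :
    (if a = n + k ∧ b = i then β i k * (1 / 2)
      else if a = i ∧ b = n + k then α i k * (1 / 2) else demandPart n α β i k a b) =
      demandPart n α β i (k + 1) a b := by
  unfold demandPart
  by_cases h1 : a = n + k ∧ b = i
  · obtain ⟨rfl, rfl⟩ := h1
    rw [if_pos ⟨rfl, rfl⟩, if_neg (by omega), if_pos (by omega), Nat.add_sub_cancel_left]
    ring
  rw [if_neg h1]
  by_cases h2 : a = i ∧ b = n + k
  · obtain ⟨rfl, rfl⟩ := h2
    rw [if_pos ⟨rfl, rfl⟩, if_pos (by omega), Nat.add_sub_cancel_left]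
    ring
  rw [if_neg h2]
  congr 1
  · apply propext
    omega
  · congr 1
    apply propext
    omega

/-- Stage `(i + 1, 0)` puts no upper bound on the other index of the completed row and column; the
additional entries are `0` since `α` and `β` vanish outside the matrix. -/
theorem demandPart_full (hα : ∀ i j, ¬ (i < n ∧ j < n) → α i j = 0)
    (hβ : ∀ i j, ¬ (i < n ∧ j < n) → β i j = 0) {i a b : ℕ} (hi : i < n) :
    demandPart n α β i n a b = demandPart n α β (i + 1) 0 a b := by
  unfold demandPart
  by_cases h1 : n ≤ b ∧ a < i + 1
  · rw [if_pos (show n ≤ b ∧ (a < i + 1 ∨ a = i + 1 ∧ b < n + 0) by omega)]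
    split_ifs with h2 h3
    · rfl
    · omega
    · rw [hα a (b - n) (by omega), zero_div]
  · rw [if_neg (show ¬ (n ≤ b ∧ (a < i ∨ a = i ∧ b < n + n)) by omega),
      if_neg (show ¬ (n ≤ b ∧ (a < i + 1 ∨ a = i + 1 ∧ b < n + 0)) by omega)]
    by_cases h2 : n ≤ a ∧ b < i + 1
    · rw [if_pos (show n ≤ a ∧ (b < i + 1 ∨ b = i + 1 ∧ a < n + 0) by omega)]
      split_ifs with h3
      · rfl
      · rw [hβ b (a - n) (by omega), zero_div]
    · rw [if_neg (show ¬ (n ≤ a ∧ (b < i ∨ b = i ∧ a < n + n)) by omega),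
        if_neg (show ¬ (n ≤ a ∧ (b < i + 1 ∨ b = i + 1 ∧ a < n + 0)) by omega)]

theorem demandPart_last (a b : ℕ) : demandPart n α β n 0 a b = demandBase n α β a b := by
  unfold demandPart demandBase
  congr 1
  · apply propext
    omega
  · congr 1
    apply propext
    omega

theorem achieves_payoffProg (hα : ∀ i j, ¬ (i < n ∧ j < n) → α i j = 0)
    (hβ : ∀ i j, ¬ (i < n ∧ j < n) → β i j = 0) {e : ℕ → ℕ → ℝ} :
    Achieves Φ (Setup n α β σ e (fun _ _ => 0) w) payoffProg (n * (n * 8 + 8) + 3)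
      (Setup n α β σ e (demandBase n α β) w) := by
  refine (Achieves.forLoop (T := n * 8 + 7) (m := n) (P := Setup n α β σ e (fun _ _ => 0) w)
    (J := fun i s => Setup n α β σ e (demandPart n α β i 0) w s ∧ s.idx 3 = i) ?_
    (fun k s h => ⟨h.2, h.1.idx0⟩) (fun i hi => ?_)).mono
      (fun _ => id) le_rfl (fun s h => h.1.congr (fun _ _ => rfl) demandPart_last fun _ => rfl)
  · intro s h
    refine ⟨(h.setIdx (by norm_num) (by norm_num) 0).congr (fun _ _ => rfl) (fun a b => ?_)
      fun _ => rfl, by simp [State.setIdx_idx]⟩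
    unfold demandPart
    rw [if_neg (by omega), if_neg (by omega)]
  · have h1 : Achieves Φ
        (fun s => Setup n α β σ e (demandPart n α β i 0) w s ∧ s.idx 3 = i)
        (.act (.copy 6 0)) 1
        (fun s => (Setup n α β σ e (demandPart n α β i 0) w s ∧ s.idx 3 = i) ∧ s.idx 6 = n) := by
      rintro s ⟨h, h3⟩
      refine ⟨1, le_rfl, _, Runs.act _ _, ⟨h.setIdx (by norm_num) (by norm_num) _, ?_⟩, ?_⟩
      · simp [Instr.exec, State.setIdx_idx, h3]
      · simp [Instr.exec, State.setIdx_idx, h.idx0]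
    have h3 : Achieves Φ
        (fun s => (Setup n α β σ e (demandPart n α β i n) w s ∧ s.idx 3 = i) ∧
          s.idx 4 = n ∧ s.idx 6 = n + n)
        (.act (.succ 3)) 1
        (fun s => Setup n α β σ e (demandPart n α β (i + 1) 0) w s ∧ s.idx 3 = i + 1) := by
      rintro s ⟨⟨h, h3⟩, -⟩
      refine ⟨1, le_rfl, _, Runs.act _ _, (h.setIdx (by norm_num) (by norm_num) _).congr
        (fun _ _ => rfl) (fun a b => demandPart_full hα hβ hi) fun _ => rfl, ?_⟩
      simp [Instr.exec, State.setIdx_idx, h3]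
    refine (h1.seq (Achieves.seq ?_ h3)).mono (T := 1 + ((n * 8 + 3) + 1 + 1) + 1)
      (fun _ => id) (by omega) (fun _ => id)
    refine Achieves.forLoop (T := 7) (m := n)
      (J := fun k s => (Setup n α β σ e (demandPart n α β i k) w s ∧ s.idx 3 = i) ∧
        s.idx 4 = k ∧ s.idx 6 = n + k) ?_ (fun k s h => ⟨h.2.1, h.1.1.idx0⟩) (fun k hk => ?_)
    · rintro s ⟨⟨h, h3⟩, h6⟩
      exact ⟨⟨h.setIdx (by norm_num) (by norm_num) _, by simp [State.setIdx_idx, h3]⟩,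
        by simp [State.setIdx_idx], by simp [State.setIdx_idx, h6]⟩
    · refine Achieves.block _ _ fun s h => ?_
      obtain ⟨⟨h, h3⟩, h4, h6⟩ := h
      refine ⟨⟨?_, ?_⟩, ?_, ?_⟩
      · constructor
        case mem17 =>
          intro a b
          rw [← demandPart_succ hi]
          simp [scalar, Instr.exec, State.read, State.write_idx, State.write_mem,
            State.setIdx_mem, h3, h4, h6, h.mem0, h.mem1, h.mem8, h.idx2, h.mem17]
        all_goals simp [scalar, Instr.exec, State.read, State.write_idx, State.write_mem,
          State.write_seed, State.setIdx_idx, State.setIdx_mem, State.setIdx_seed, h.idx0, h.idx1,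
          h.idx2, h3, h4, h6, h.idx16, h.idx17, h.mem0, h.mem1, h.mem5, h.mem7, h.mem8, h.mem16,
          h.mem18, h.seed]
      all_goals simp [scalar, Instr.exec, State.setIdx_idx, State.write_idx, h3, h4, h6]
      all_goals omega

/-- The matrix `base` after the noise has been added to `i` rows and `k` entries of the next
row. -/
def noisePart (N : ℕ) (σ : ℝ) (w : ℕ → ℝ) (off : ℕ) (base : ℕ → ℕ → ℝ) (i k a b : ℕ) : ℝ :=
  if a < i ∧ b < N ∨ a = i ∧ b < k then base a b + σ * (1 + 2 * w (2 * (a * N + b) + off))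
  else base a b

theorem noisePart_full {N off i a b : ℕ} {base : ℕ → ℕ → ℝ} :
    noisePart N σ w off base i N a b = noisePart N σ w off base (i + 1) 0 a b := by
  unfold noisePart
  congr 1
  apply propext
  omega

theorem noisePart_succ {N off i k a b : ℕ} {base : ℕ → ℕ → ℝ} {y : ℝ}
    (hy : y = σ * (1 + 2 * w (2 * (i * N + k) + off))) :
    (if a = i ∧ b = k then noisePart N σ w off base i k i k + y
      else noisePart N σ w off base i k a b) = noisePart N σ w off base i (k + 1) a b := by
  unfold noisePart
  by_cases h : a = i ∧ b = k
  · obtain ⟨rfl, rfl⟩ := h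
    rw [if_pos ⟨rfl, rfl⟩, if_neg (by omega), if_pos (by omega), hy]
  · rw [if_neg h]
    congr 1
    apply propext
    omega

theorem achieves_noiseProg {e d : ℕ → ℕ → ℝ} :
    Achieves Φ (Setup n α β σ e d w) noiseProg ((n + n) * ((n + n) * 22 + 6) + 3)
      (fun s => ∃ w', Setup n α β σ (noisePart (n + n) σ w 0 e (n + n) 0)
        (noisePart (n + n) σ w 1 d (n + n) 0) w' s) := by
  set N := n + n with hN
  -- Each position consumes two draws, an even one for the endowment and an odd one for the demand,
  -- so `i` rows advance the stream by `2 * (i * N)`.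
  refine (Achieves.forLoop (T := N * 22 + 5) (m := N) (P := Setup n α β σ e d w)
    (J := fun i s => Setup n α β σ (noisePart N σ w 0 e i 0) (noisePart N σ w 1 d i 0)
      (fun m => w (m + 2 * (i * N))) s ∧ s.idx 3 = i) ?_
    (fun k s h => ⟨h.2, h.1.idx1⟩) (fun i hi => ?_)).mono
      (fun _ => id) le_rfl (fun s h => ⟨_, h.1⟩)
  · intro s h
    refine ⟨(h.setIdx (by norm_num) (by norm_num) 0).congr (fun a b => ?_) (fun a b => ?_)
      (by simp), by simp [State.setIdx_idx]⟩ <;>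
    · unfold noisePart
      rw [if_neg (by omega)]
  · have h3 : Achieves Φ
        (fun s => (Setup n α β σ (noisePart N σ w 0 e i N) (noisePart N σ w 1 d i N)
          (fun m => w (m + 2 * (i * N + N))) s ∧ s.idx 3 = i) ∧ s.idx 4 = N)
        (.act (.succ 3)) 1
        (fun s => Setup n α β σ (noisePart N σ w 0 e (i + 1) 0) (noisePart N σ w 1 d (i + 1) 0)
          (fun m => w (m + 2 * ((i + 1) * N))) s ∧ s.idx 3 = i + 1) := by
      rintro s ⟨⟨h, h3⟩, -⟩
      refine ⟨1, le_rfl, _, Runs.act _ _, (h.setIdx (by norm_num) (by norm_num) _).congr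
        (fun a b => noisePart_full) (fun a b => noisePart_full)
        fun m => by rw [Nat.add_mul, one_mul], ?_⟩
      simp [Instr.exec, State.setIdx_idx, h3]
    refine Achieves.mono (T := (N * 22 + 3) + 1 + 1) (Achieves.seq ?_ h3)
      (fun _ => id) (by omega) (fun _ => id)
    refine Achieves.forLoop (T := 21) (m := N)
      (J := fun k s => (Setup n α β σ (noisePart N σ w 0 e i k) (noisePart N σ w 1 d i k)
          (fun m => w (m + 2 * (i * N + k))) s ∧ s.idx 3 = i) ∧ s.idx 4 = k) ?_
      (fun k s h => ⟨h.2, h.1.1.idx1⟩) (fun k hk => ?_)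
    · rintro s ⟨h, h3⟩
      exact ⟨⟨h.setIdx (by norm_num) (by norm_num) _, by simp [State.setIdx_idx, h3]⟩,
        by simp [State.setIdx_idx]⟩
    · refine Achieves.block _ _ fun s h => ?_
      obtain ⟨⟨h, h3⟩, h4⟩ := h
      refine ⟨⟨?_, ?_⟩, ?_⟩
      · constructor
        case mem16 =>
          intro a b
          simp [scalar, Instr.exec, State.read, State.write_idx, State.write_mem,
            State.write_seed, State.setIdx_mem, h3, h4, h.mem5, h.mem7, h.idx2, h.mem16, h.seed]
          exact noisePart_succ (by ring_nf)
        case mem17 =>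
          intro a b
          simp [scalar, Instr.exec, State.read, State.write_idx, State.write_mem,
            State.write_seed, State.setIdx_mem, h3, h4, h.mem5, h.mem7, h.idx2, h.mem17, h.seed]
          exact noisePart_succ (by ring_nf)
        case seed =>
          intro m
          simp [scalar, Instr.exec, State.write_seed, State.setIdx_seed, h.seed]
          congr 1
          omega
        all_goals simp [scalar, Instr.exec, State.read, State.write_idx, State.write_mem,
          State.write_seed, State.setIdx_idx, State.setIdx_mem, h.idx0, h.idx1,
          h.idx2, h3, h4, h.idx16, h.idx17, h.mem0, h.mem1, h.mem5, h.mem7, h.mem8, h.mem18]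
      all_goals simp [scalar, Instr.exec, State.setIdx_idx, State.write_idx, h3, h4]

theorem achieves_setupProg (hn : 1 ≤ n) (hα : ∀ i j, ¬ (i < n ∧ j < n) → α i j = 0)
    (hβ : ∀ i j, ¬ (i < n ∧ j < n) → β i j = 0) :
    Achieves Φ (Init n α β ε w) setupProg (200 * n ^ 2)
      (fun s => ∃ w', Setup n α β (ε / (512 * n))
        (noisePart (n + n) (ε / (512 * n)) w 0 (endowBase n) (n + n) 0)
        (noisePart (n + n) (ε / (512 * n)) w 1 (demandBase n α β) (n + n) 0) w' s) := by
  refine (achieves_constProg.seq (achieves_diagProg.seq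
    ((achieves_payoffProg hα hβ).seq achieves_noiseProg))).mono (fun _ => id) ?_ (fun _ => id)
  nlinarith

/-- The memory during the final phase. -/
structure Final (n : ℕ) (U : ℕ → ℝ) (s : State) : Prop where
  idx0 : s.idx 0 = n
  idx2 : s.idx 2 = 0
  mem18 : ∀ j, s.mem 18 0 j = U j

theorem achieves_sumProg {U : ℕ → ℝ} :
    Achieves Φ (Final n U) sumProg (n * 8 + 9) (fun s => Final n U s ∧
      s.mem 10 0 0 = ∑ k ∈ Finset.range n, U k ∧
      s.mem 11 0 0 = ∑ k ∈ Finset.range n, U (n + k)) := by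
  -- `Final` records nothing about these scalars; subtracting each from itself clears it.
  have h1 : Achieves Φ (Final n U) (block (.sub (scalar 10) (scalar 10) (scalar 10))
      [.sub (scalar 11) (scalar 11) (scalar 11), .copy 6 0]) 5
      (fun s => Final n U s ∧ s.mem 10 0 0 = 0 ∧ s.mem 11 0 0 = 0 ∧ s.idx 6 = n) := by
    refine Achieves.block _ _ fun s h => ⟨?_, ?_, ?_, ?_⟩
    · constructor <;> simp [scalar, Instr.exec, State.read, State.write_idx, State.write_mem,
        State.setIdx_idx, State.setIdx_mem, h.idx0, h.idx2, h.mem18]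
    all_goals simp [scalar, Instr.exec, State.read, State.write_idx, State.write_mem,
        State.setIdx_idx, State.setIdx_mem, h.idx0, h.idx2]
  refine (h1.seq (Achieves.forLoop (T := 7) (m := n)
    (J := fun k s => Final n U s ∧ s.mem 10 0 0 = ∑ k ∈ Finset.range k, U k ∧
      s.mem 11 0 0 = ∑ k ∈ Finset.range k, U (n + k) ∧ s.idx 4 = k ∧ s.idx 6 = n + k) ?_
    (fun k s h => ⟨h.2.2.2.1, h.1.idx0⟩) (fun k _ => ?_))).mono (fun _ => id) (by omega)
    (fun s h => ⟨h.1, h.2.1, h.2.2.1⟩)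
  · rintro s ⟨h, h10, h11, h6⟩
    refine ⟨?_, ?_, ?_, ?_, ?_⟩
    · constructor <;> simp [State.setIdx_idx, State.setIdx_mem, h.idx0, h.idx2, h.mem18]
    all_goals simp [State.setIdx_idx, State.setIdx_mem, h10, h11, h6]
  · refine Achieves.block _ _ fun s h => ?_
    obtain ⟨h, h10, h11, h4, h6⟩ := h
    refine ⟨?_, ?_, ?_, ?_, ?_⟩
    · constructor <;> simp [scalar, Instr.exec, State.read, State.write_idx, State.write_mem,
        State.setIdx_idx, State.setIdx_mem, h.idx0, h.idx2, h.mem18]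
    all_goals simp [scalar, Instr.exec, State.read, State.write_idx, State.write_mem,
        State.setIdx_idx, State.setIdx_mem, h.idx2, h10, h11, h4, h6, h.mem18,
        Finset.sum_range_succ]
    all_goals omega

theorem achieves_normalizeProg {U : ℕ → ℝ} :
    Achieves Φ (Final n U) normalizeProg (n * 16 + 16) (fun s => ∀ j < n,
      s.mem 3 0 j = U j / ∑ k ∈ Finset.range n, U k ∧
      s.mem 4 0 j = U (n + j) / ∑ k ∈ Finset.range n, U (n + k)) := by
  set S₁ := ∑ k ∈ Finset.range n, U k
  set S₂ := ∑ k ∈ Finset.range n, U (n + k)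
  have h1 : Achieves Φ (fun s => Final n U s ∧ s.mem 10 0 0 = S₁ ∧ s.mem 11 0 0 = S₂)
      (.act (.copy 6 0)) 1
      (fun s => (Final n U s ∧ s.mem 10 0 0 = S₁ ∧ s.mem 11 0 0 = S₂) ∧ s.idx 6 = n) := by
    rintro s ⟨h, h10, h11⟩
    refine ⟨1, le_rfl, _, Runs.act _ _, ⟨?_, ?_, ?_⟩, ?_⟩
    · constructor <;> simp [Instr.exec, State.setIdx_idx, State.setIdx_mem, h.idx0, h.idx2,
        h.mem18]
    all_goals simp [Instr.exec, State.setIdx_idx, State.setIdx_mem, h.idx0, h10, h11]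
  refine (achieves_sumProg.seq (h1.seq (Achieves.forLoop (T := 7) (m := n)
    (J := fun k s => (Final n U s ∧ s.mem 10 0 0 = S₁ ∧ s.mem 11 0 0 = S₂) ∧
      (s.idx 4 = k ∧ s.idx 6 = n + k) ∧
      ∀ j < k, s.mem 3 0 j = U j / S₁ ∧ s.mem 4 0 j = U (n + j) / S₂) ?_
    (fun k s h => ⟨h.2.1.1, h.1.1.idx0⟩) (fun k _ => ?_)))).mono (fun _ => id) (by omega)
    (fun s h => h.2.2)
  · rintro s ⟨⟨h, h10, h11⟩, h6⟩
    refine ⟨⟨?_, ?_, ?_⟩, ⟨?_, ?_⟩, ?_⟩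
    · constructor <;> simp [State.setIdx_idx, State.setIdx_mem, h.idx0, h.idx2, h.mem18]
    all_goals simp [State.setIdx_idx, State.setIdx_mem, h10, h11, h6]
  · refine Achieves.block _ _ fun s h => ?_
    obtain ⟨⟨h, h10, h11⟩, ⟨h4, h6⟩, hx⟩ := h
    refine ⟨⟨?_, ?_, ?_⟩, ⟨?_, ?_⟩, ?_⟩
    · constructor <;> simp [scalar, Instr.exec, State.read, State.write_idx, State.write_mem,
        State.setIdx_idx, State.setIdx_mem, h.idx0, h.idx2, h.mem18]
    case refine_6 =>
      intro j hj
      simp [scalar, Instr.exec, State.read, State.write_idx, State.write_mem,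
        State.setIdx_mem, h.idx2, h10, h11, h4, h6, h.mem18]
      by_cases hjk : j = k
      · simp [hjk]
      · simpa [hjk] using hx j (by omega)
    all_goals simp [scalar, Instr.exec, State.read, State.write_idx, State.write_mem,
        State.setIdx_idx, State.setIdx_mem, h.idx2, h10, h11, h4, h6, h.mem18]
    all_goals omega

end GameReduction

/-! ### Correctness and expected running time of the reduction -/

namespace GameReduction

open RealRAM MeasureTheory

variable {ι : Type*} {Φ : ι → (r : ℕ) → (Fin r → ℝ) → ℝ}

theorem ofMatrix_eq_zero {n : ℕ} (M : Matrix (Fin n) (Fin n) ℝ) (i j : ℕ)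
    (h : ¬ (i < n ∧ j < n)) : ofMatrix M i j = 0 := dif_neg h

theorem ofMatrix_val {n : ℕ} (M : Matrix (Fin n) (Fin n) ℝ) (i j : Fin n) :
    ofMatrix M i j = M i j := dif_pos ⟨i.2, j.2⟩

/-- The place in the stream of random numbers of the noise of each entry. -/
def drawIndex (N : ℕ) : (Fin N × Fin N) ⊕ (Fin N × Fin N) → ℕ
  | .inl q => 2 * (q.1 * N + q.2)
  | .inr q => 2 * (q.1 * N + q.2) + 1

theorem drawIndex_injective (N : ℕ) : Function.Injective (drawIndex N) := by
  have key : ∀ p q : Fin N × Fin N, (p.1 : ℕ) * N + p.2 = q.1 * N + q.2 → p = q := by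
    intro p q h
    have hp := p.2.2
    have hq := q.2.2
    have h1 : ((p.1 : ℕ) * N + p.2) / N = ((q.1 : ℕ) * N + q.2) / N := by rw [h]
    rw [Nat.mul_comm, Nat.mul_comm (q.1 : ℕ), Nat.mul_add_div (by omega), Nat.mul_add_div (by omega),
      Nat.div_eq_of_lt hp, Nat.div_eq_of_lt hq, add_zero, add_zero] at h1
    rw [h1] at h
    exact Prod.ext (Fin.ext h1) (Fin.ext (by omega))
  rintro (p | p) (q | q) h <;> simp only [drawIndex] at h
  · rw [key p q (by omega)]
  · omega
  · omega
  · rw [key p q (by omega)]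

variable {n : ℕ}

/-- The means of the endowments. -/
def meanE (n : ℕ) (σ : ℝ) : Matrix (Fin (n + n)) (Fin (n + n)) ℝ :=
  Matrix.of fun i j => endowBase n i j + 2 * σ

/-- The means of the demands. -/
def meanD (A B : Matrix (Fin n) (Fin n) ℝ) (σ : ℝ) : Matrix (Fin (n + n)) (Fin (n + n)) ℝ :=
  Matrix.of fun i j => demandBase n (ofMatrix A) (ofMatrix B) i j + 2 * σ

/-- The perturbed endowments. -/
def randE (n : ℕ) (σ : ℝ) (Δ : Fin (n + n) × Fin (n + n) → ℝ) :
    Matrix (Fin (n + n)) (Fin (n + n)) ℝ := Leontief.perturb (meanE n σ) Δ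

/-- The perturbed demands. -/
def randD (A B : Matrix (Fin n) (Fin n) ℝ) (σ : ℝ) (Δ : Fin (n + n) × Fin (n + n) → ℝ) :
    Matrix (Fin (n + n)) (Fin (n + n)) ℝ := Leontief.perturb (meanD A B σ) Δ

theorem endowBase_mem (i j : ℕ) : 0 ≤ endowBase n i j ∧ endowBase n i j ≤ 1 / 2 := by
  unfold endowBase
  split_ifs <;> norm_num

theorem demandBase_mem {A B : Matrix (Fin n) (Fin n) ℝ} (hA : ∀ i j, 1 ≤ A i j ∧ A i j ≤ 2)
    (hB : ∀ i j, 1 ≤ B i j ∧ B i j ≤ 2) (i j : ℕ) :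
    0 ≤ demandBase n (ofMatrix A) (ofMatrix B) i j ∧
      demandBase n (ofMatrix A) (ofMatrix B) i j ≤ 1 := by
  have key : ∀ (M : Matrix (Fin n) (Fin n) ℝ), (∀ i j, 1 ≤ M i j ∧ M i j ≤ 2) → ∀ i j,
      0 ≤ ofMatrix M i j / 2 ∧ ofMatrix M i j / 2 ≤ 1 := by
    intro M hM i j
    unfold ofMatrix
    split_ifs with h
    · have := hM ⟨i, h.1⟩ ⟨j, h.2⟩
      constructor <;> linarith [this.1, this.2]
    · norm_num
  unfold demandBase
  split_ifs
  · exact key A hA _ _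
  · exact key B hB _ _
  · norm_num

/-- The shift of the mean by `2 σ` outweighs the noise, so clipping at `0` has no effect. -/
theorem perturb_apply_of_mem {N : ℕ} {M : Matrix (Fin N) (Fin N) ℝ} {Δ : Fin N × Fin N → ℝ}
    {σ b : ℝ} {i j : Fin N} (hσ : 0 ≤ σ) (hM : M i j = b + 2 * σ) (hb : 0 ≤ b)
    (hΔ : Δ (i, j) ∈ Set.Icc (-σ) σ) :
    Leontief.perturb M Δ i j = b + (2 * σ + Δ (i, j)) := by
  have := hΔ.1
  rw [Leontief.perturb, Matrix.of_apply, hM, max_eq_left (by linarith), add_assoc]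

/-! ### The random economy of a game -/

section Noise

variable {A B : Matrix (Fin n) (Fin n) ℝ} {σ : ℝ} {Δ : Fin (n + n) × Fin (n + n) → ℝ}

theorem randE_apply (hσ : 0 ≤ σ) (hΔ : ∀ q, Δ q ∈ Set.Icc (-σ) σ) (i j : Fin (n + n)) :
    randE n σ Δ i j = endowBase n i j + (2 * σ + Δ (i, j)) :=
  perturb_apply_of_mem hσ rfl (endowBase_mem _ _).1 (hΔ _)

theorem randD_apply (hA : ∀ i j, 1 ≤ A i j ∧ A i j ≤ 2) (hB : ∀ i j, 1 ≤ B i j ∧ B i j ≤ 2)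
    (hσ : 0 ≤ σ) (hΔ : ∀ q, Δ q ∈ Set.Icc (-σ) σ) (i j : Fin (n + n)) :
    randD A B σ Δ i j =
      demandBase n (ofMatrix A) (ofMatrix B) i j + (2 * σ + Δ (i, j)) :=
  perturb_apply_of_mem hσ rfl (demandBase_mem hA hB _ _).1 (hΔ _)

theorem randE_nonneg (i j : Fin (n + n)) : 0 ≤ randE n σ Δ i j := le_max_right _ _

theorem randD_pos (hA : ∀ i j, 1 ≤ A i j ∧ A i j ≤ 2) (hB : ∀ i j, 1 ≤ B i j ∧ B i j ≤ 2)
    (hσ : 0 < σ) (hΔ : ∀ q, Δ q ∈ Set.Icc (-σ) σ) (i j : Fin (n + n)) :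
    0 < randD A B σ Δ i j := by
  rw [randD_apply hA hB hσ.le hΔ]
  have := (demandBase_mem hA hB i j).1
  have := (hΔ (i, j)).1
  linarith

theorem exists_isEquilibrium_rand (hn : 1 ≤ n) (hA : ∀ i j, 1 ≤ A i j ∧ A i j ≤ 2)
    (hB : ∀ i j, 1 ≤ B i j ∧ B i j ≤ 2) (hσ : 0 < σ) (hΔ : ∀ q, Δ q ∈ Set.Icc (-σ) σ)
    (E : Matrix (Fin (n + n)) (Fin (n + n)) ℝ) :
    ∃ u p, Leontief.IsEquilibrium E (randD A B σ Δ) u p :=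
  Leontief.exists_isEquilibrium (by omega) _ _ (randD_pos hA hB hσ hΔ)

theorem nearGameEconomy_rand (hA : ∀ i j, 1 ≤ A i j ∧ A i j ≤ 2)
    (hB : ∀ i j, 1 ≤ B i j ∧ B i j ≤ 2) (hσ : 0 < σ) {Δ₁ Δ₂ : Fin (n + n) × Fin (n + n) → ℝ}
    (h₁ : ∀ q, Δ₁ q ∈ Set.Icc (-σ) σ) (h₂ : ∀ q, Δ₂ q ∈ Set.Icc (-σ) σ) :
    Bimatrix.NearGameEconomy A B (3 * σ) (randE n σ Δ₁) (randD A B σ Δ₂) := by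
  have key : ∀ x ∈ Set.Icc (-σ) σ, 0 ≤ 2 * σ + x ∧ 2 * σ + x ≤ 3 * σ := fun x hx => by
    constructor <;> linarith [hx.1, hx.2]
  constructor
  · intro i j
    rw [randE_apply hσ.le h₁]
    have := key _ (h₁ (i, j))
    have he : endowBase n i j = if i = j then 1 / 2 else 0 := by
      simp [endowBase, Fin.val_inj, i.2]
    rw [he]
    constructor <;> linarith [this.1, this.2]
  all_goals
    intro i j
    rw [randD_apply hA hB hσ.le h₂]
  · have he : demandBase n (ofMatrix A) (ofMatrix B) (Fin.castAdd n i) (Fin.castAdd n j) = 0 := by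
      simp [demandBase, i.2.not_ge, j.2.not_ge]
    rw [he, zero_add]
    exact key _ (h₂ _)
  · have he : demandBase n (ofMatrix A) (ofMatrix B) (Fin.castAdd n i) (Fin.natAdd n j) =
        A i j / 2 := by
      simp [demandBase, ofMatrix_val]
    rw [he]
    have := key _ (h₂ (Fin.castAdd n i, Fin.natAdd n j))
    constructor <;> linarith [this.1, this.2]
  · have he : demandBase n (ofMatrix A) (ofMatrix B) (Fin.natAdd n i) (Fin.castAdd n j) =
        B j i / 2 := by
      simp [demandBase, ofMatrix_val]
    rw [he]
    have := key _ (h₂ (Fin.natAdd n i, Fin.castAdd n j))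
    constructor <;> linarith [this.1, this.2]
  · have he : demandBase n (ofMatrix A) (ofMatrix B) (Fin.natAdd n i) (Fin.natAdd n j) = 0 := by
      simp [demandBase]
    rw [he, zero_add]
    exact key _ (h₂ _)

theorem measurable_perturb {N : ℕ} (M : Matrix (Fin N) (Fin N) ℝ) (i j : ℕ) :
    Measurable fun Δ : Fin N × Fin N → ℝ => ofMatrix (Leontief.perturb M Δ) i j := by
  unfold ofMatrix
  split_ifs with h
  · simp only [Leontief.perturb, Matrix.of_apply]
    fun_prop
  · fun_prop

theorem measurable_runTime_perturb (hΦ : ∀ o r, Measurable (Φ o r)) (W : Prog ι) {N : ℕ}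
    (E D : Matrix (Fin N) (Fin N) ℝ) :
    Measurable fun Δ : (Fin N × Fin N → ℝ) × (Fin N × Fin N → ℝ) =>
      runTime Φ W (Leontief.input (Leontief.perturb E Δ.1) (Leontief.perturb D Δ.2)) := by
  refine MeasurableState.measurable_runTime hΦ ⟨fun r => ?_, fun a i j => ?_, fun k => ?_⟩ W
  · exact measurable_const
  · simp only [Leontief.input]
    split_ifs
    · exact (measurable_perturb E i j).comp measurable_fst
    · exact (measurable_perturb D i j).comp measurable_snd
    · exact measurable_const
  · exact measurable_const

/-- The expected running time of `W` on the random economy. -/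
theorem lintegral_runTime_le (hΦ : ∀ o r, Measurable (Φ o r)) (W : Prog ι) (hn : 1 ≤ n)
    (hA : ∀ i j, 1 ≤ A i j ∧ A i j ≤ 2) (hB : ∀ i j, 1 ≤ B i j ∧ B i j ≤ 2) (hσ : 0 < σ) :
    ∫⁻ ω, runTime Φ W (Leontief.input (randE n σ (noise σ (drawIndex (n + n)) ω).1)
      (randD A B σ (noise σ (drawIndex (n + n)) ω).2)) ∂seedLaw ≤
      Leontief.expectedTime Φ W (meanE n σ) (meanD A B σ) σ := by
  set f := drawIndex (n + n)
  have hm := measurable_runTime_perturb hΦ W (meanE n σ) (meanD A B σ)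
  unfold Leontief.expectedTime
  rw [← map_noise hσ (drawIndex_injective (n + n))]
  -- For a function that is not measurable only the opposite inequality is available. So `runTime`
  -- is transported first, and compared with `solveTime` only afterwards.
  refine le_trans (lintegral_map hm (measurable_noise σ f)).ge (lintegral_mono_ae ?_)
  have hbox : MeasurableSet {Δ : (Fin (n + n) × Fin (n + n) → ℝ) × (Fin (n + n) × Fin (n + n) → ℝ) |
      ∀ q, Δ.2 q ∈ Set.Icc (-σ) σ} := by
    simp only [Set.ofPred_forall]
    refine MeasurableSet.iInter fun q => ?_
    exact (show Measurable fun Δ : (Fin (n + n) × Fin (n + n) → ℝ) ×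
      (Fin (n + n) × Fin (n + n) → ℝ) => Δ.2 q by fun_prop) measurableSet_Icc
  -- Where the demand noise is in range the demands are positive, an equilibrium exists, and
  -- `solveTime` equals `runTime`.
  have hae : ∀ᵐ Δ ∂(seedLaw.map (noise σ f)), ∀ q, Δ.2 q ∈ Set.Icc (-σ) σ := by
    rw [ae_map_iff (measurable_noise σ f).aemeasurable hbox]
    exact Filter.Eventually.of_forall fun ω q => (noise_mem hσ f ω q).2
  filter_upwards [hae] with Δ hΔ
  have heq : ∃ u p, Leontief.IsEquilibrium (Leontief.perturb (meanE n σ) Δ.1)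
      (Leontief.perturb (meanD A B σ) Δ.2) u p := exists_isEquilibrium_rand hn hA hB hσ hΔ _
  rw [Leontief.solveTime, if_pos heq]

end Noise

/-! ### Correctness and cost of the whole program -/

section Program

variable {A B : Matrix (Fin n) (Fin n) ℝ} {ε : ℝ}

theorem init_input (A B : Matrix (Fin n) (Fin n) ℝ) (ε : ℝ) (ω : ℕ → unitInterval) :
    Init n (ofMatrix A) (ofMatrix B) ε (fun k => (ω k : ℝ)) (Bimatrix.input A B ε ω) := by
  constructor <;> simp [Bimatrix.input]

theorem ofMatrix_rand {σ : ℝ} {M : Matrix (Fin (n + n)) (Fin (n + n)) ℝ} {base : ℕ → ℕ → ℝ}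
    {w : ℕ → ℝ} {off : ℕ} (hbase : ∀ i j, ¬ (i < n + n ∧ j < n + n) → base i j = 0)
    (hM : ∀ i j, M i j = base i j + (2 * σ + σ * (2 * w (2 * (i * (n + n) + j) + off) - 1)))
    (i j : ℕ) : noisePart (n + n) σ w off base (n + n) 0 i j = ofMatrix M i j := by
  unfold noisePart ofMatrix
  by_cases h : i < n + n ∧ j < n + n
  · rw [if_pos (.inl h), dif_pos h, hM]
    ring
  · rw [if_neg (by omega), dif_neg h, hbase i j h]

theorem setup_run (hn : 1 ≤ n) (hA : ∀ i j, 1 ≤ A i j ∧ A i j ≤ 2)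
    (hB : ∀ i j, 1 ≤ B i j ∧ B i j ≤ 2) (hε : 0 < ε) {σ : ℝ} (hσ : σ = ε / (512 * n))
    (ω : ℕ → unitInterval) :
    ∃ t ≤ 200 * n ^ 2, ∃ s, Runs Φ setupProg (Bimatrix.input A B ε ω) t s ∧
      s.idx 0 = n ∧ s.idx 2 = 0 ∧
      Embeds 16 s (Leontief.input (randE n σ (noise σ (drawIndex (n + n)) ω).1)
        (randD A B σ (noise σ (drawIndex (n + n)) ω).2)) s := by
  obtain ⟨t, ht, s, hs, w', h⟩ := achieves_setupProg (Φ := Φ) hn (ofMatrix_eq_zero A)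
    (ofMatrix_eq_zero B) _ (init_input A B ε ω)
  have hσ0 : 0 < σ := by
    rw [hσ]
    have : (0 : ℝ) < n := by exact_mod_cast hn
    positivity
  rw [← hσ] at h
  have hE : ∀ i j, s.mem 16 i j =
      ofMatrix (randE n σ (noise σ (drawIndex (n + n)) ω).1) i j := fun i j => by
    rw [h.mem16]
    refine ofMatrix_rand (fun i j hij => ?_) (fun i j => ?_) i j
    · unfold endowBase
      rw [if_neg (by omega)]
    · rw [randE_apply hσ0.le fun q => (noise_mem hσ0 _ ω q).1]
      rfl
  have hD : ∀ i j, s.mem 17 i j =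
      ofMatrix (randD A B σ (noise σ (drawIndex (n + n)) ω).2) i j := fun i j => by
    rw [h.mem17]
    refine ofMatrix_rand (fun i j hij => ?_) (fun i j => ?_) i j
    · unfold demandBase
      split_ifs
      · rw [ofMatrix_eq_zero A _ _ (by omega), zero_div]
      · rw [ofMatrix_eq_zero B _ _ (by omega), zero_div]
      · rfl
    · rw [randD_apply hA hB hσ0.le fun q => (noise_mem hσ0 _ ω q).2]
      rfl
  -- From number `16` on, the memory is exactly a fresh input for `W`, all further registers and
  -- arrays being `0`.
  refine ⟨t, ht, s, hs, h.idx0, h.idx2, ⟨?_, ?_, fun _ _ => rfl, fun _ _ => rfl⟩⟩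
  · rintro (_ | r)
    · simp [Leontief.input, h.idx16]
    · have := h.idx17 r
      rw [show r + 1 + 16 = r + 17 by omega]
      simp [Leontief.input, this]
  · rintro (_ | _ | a) i j
    · simp [Leontief.input, hE]
    · simp [Leontief.input, hD]
    · have := h.mem18 a i j
      rw [show a + 1 + 1 + 16 = a + 18 by omega]
      simp [Leontief.input, this]

theorem final_of_embeds {s₁ t s₂ : State} (h0 : s₁.idx 0 = n) (h2 : s₁.idx 2 = 0)
    (h : Embeds 16 s₁ t s₂) : Final n (t.mem 2 0) s₂ :=
  ⟨by rw [h.idx_low 0 (by norm_num), h0], by rw [h.idx_low 2 (by norm_num), h2],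
    fun j => h.mem 2 0 j⟩

theorem isApproxNash_gameProg {W : Prog ι} (hW : Leontief.Computes Φ W) (hn : 1 ≤ n)
    (hA : ∀ i j, 1 ≤ A i j ∧ A i j ≤ 2) (hB : ∀ i j, 1 ≤ B i j ∧ B i j ≤ 2) (hε : 0 < ε)
    (hε1 : ε < 1) (ω : ℕ → unitInterval) {s' : State}
    (hs' : HaltsWith Φ (gameProg W) (Bimatrix.input A B ε ω) s') :
    Bimatrix.IsApproxNash A B ε (fun i => s'.mem 3 0 i) (fun j => s'.mem 4 0 j) := by
  set σ := ε / (512 * n) with hσ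
  have hn0 : (0 : ℝ) < n := by exact_mod_cast hn
  have hσ0 : 0 < σ := by positivity
  obtain ⟨t, -, s₁, hrun, h0, h2, hemb⟩ := setup_run (Φ := Φ) hn hA hB hε hσ ω
  obtain ⟨s₂, hs₂, hpost⟩ := HaltsWith.of_seq_seq hrun hs'
  obtain ⟨t₂, ht₂, hemb₂⟩ := hemb.exists_haltsWith hW.1 hs₂
  set Δ := noise σ (drawIndex (n + n)) ω
  have hΔ₁ : ∀ q, Δ.1 q ∈ Set.Icc (-σ) σ := fun q => (noise_mem hσ0 _ ω q).1
  have hΔ₂ : ∀ q, Δ.2 q ∈ Set.Icc (-σ) σ := fun q => (noise_mem hσ0 _ ω q).2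
  have heq := hW.2 (n + n) _ _ (by omega) randE_nonneg
    (fun i j => (randD_pos hA hB hσ0 hΔ₂ i j).le)
    (exists_isEquilibrium_rand hn hA hB hσ0 hΔ₂ _) t₂ ht₂
  -- With `τ = 3 σ` the requirement `n τ ≤ 3 ε / 512` holds with equality; this is what fixes `σ`.
  have hnash := Bimatrix.isApproxNash_of_isEquilibrium (ε := ε) hn hA hB (by positivity)
    (le_of_eq (by rw [hσ]; field_simp)) hε1.le (nearGameEconomy_rand hA hB hσ0 hΔ₁ hΔ₂) heq
  obtain ⟨t₃, -, s₃, hrun₃, hout⟩ := achieves_normalizeProg (Φ := Φ) s₂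
    (final_of_embeds h0 h2 hemb₂)
  obtain rfl := hrun₃.haltsWith.unique hpost
  convert hnash using 2 with i j
  · rw [(hout i i.2).1, Finset.sum_range]
    rfl
  · rw [(hout j j.2).2, Finset.sum_range]
    rfl

theorem runTime_gameProg_le {W : Prog ι} (hW : W.Deterministic) (hn : 1 ≤ n)
    (hA : ∀ i j, 1 ≤ A i j ∧ A i j ≤ 2) (hB : ∀ i j, 1 ≤ B i j ∧ B i j ≤ 2) (hε : 0 < ε)
    {σ : ℝ} (hσ : σ = ε / (512 * n)) (ω : ℕ → unitInterval) :
    runTime Φ (gameProg W) (Bimatrix.input A B ε ω) ≤ ((300 * n ^ 2 : ℕ) : ℝ≥0∞) +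
      runTime Φ W (Leontief.input (randE n σ (noise σ (drawIndex (n + n)) ω).1)
        (randD A B σ (noise σ (drawIndex (n + n)) ω).2)) := by
  obtain ⟨t, ht, s₁, hrun, h0, h2, hemb⟩ := setup_run (Φ := Φ) hn hA hB hε hσ ω
  rw [← hemb.runTime_shift hW]
  refine (runTime_seq_seq_le (T := n * 16 + 16) hrun fun s₂ hs₂ => ?_).trans ?_
  · obtain ⟨t₂, -, hemb₂⟩ := hemb.exists_haltsWith hW hs₂
    obtain ⟨t₃, ht₃, s₃, hrun₃, -⟩ := achieves_normalizeProg (Φ := Φ) s₂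
      (final_of_embeds h0 h2 hemb₂)
    exact ⟨t₃, ht₃, s₃, hrun₃⟩
  · gcongr
    nlinarith

end Program

end GameReduction

end

theorem lemma3 {ι : Type*} (Φ : ι → (r : ℕ) → (Fin r → ℝ) → ℝ)
    (hΦ : ∀ o r, Measurable (Φ o r))
    (hsmooth : Leontief.InSmoothedPolyTime Φ) :
    ∃ (M : RealRAM.Prog ι) (c : ℝ) (k₁ k₂ : ℕ), 0 < c ∧
      ∀ (n : ℕ) (A B : Matrix (Fin n) (Fin n) ℝ) (ε : ℝ), 1 ≤ n →
        (∀ i j, 1 ≤ A i j ∧ A i j ≤ 2) → (∀ i j, 1 ≤ B i j ∧ B i j ≤ 2) →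
        0 < ε → ε < 1 →
        (∀ (ω : ℕ → unitInterval) (s' : RealRAM.State),
          RealRAM.HaltsWith Φ M (Bimatrix.input A B ε ω) s' →
            Bimatrix.IsApproxNash A B ε (fun i => s'.mem 3 0 i) (fun j => s'.mem 4 0 j)) ∧
        ∫⁻ ω, RealRAM.runTime Φ M (Bimatrix.input A B ε ω) ∂(RealRAM.seedLaw)
          ≤ ENNReal.ofReal (c * (n : ℝ) ^ k₁ * (1 / ε) ^ k₂) := by
  obtain ⟨W, hW, c, k₁, k₂, hc, htime⟩ := hsmooth
  -- The overhead is `300 n ^ 2`; the call of `W` costs `c (2n) ^ k₁ (512 n / ε) ^ k₂` in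
  -- expectation. One exponent `k₁ + k₂ + 2` covers both.
  refine ⟨GameReduction.gameProg W, 300 + c * 2 ^ k₁ * 512 ^ k₂, k₁ + k₂ + 2, k₂, by positivity,
    fun n A B ε hn hA hB hε hε1 => ⟨fun ω s' hs' =>
      GameReduction.isApproxNash_gameProg hW hn hA hB hε hε1 ω hs', ?_⟩⟩
  set σ := ε / (512 * n) with hσ
  have hn1 : (1 : ℝ) ≤ n := by exact_mod_cast hn
  have hn0 : (0 : ℝ) < n := by linarith
  have hσ0 : 0 < σ := by positivity
  have hσ1 : σ ≤ 1 / 512 := by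
    rw [hσ, div_le_div_iff₀ (by positivity) (by norm_num)]
    nlinarith
  have hexp := htime (n + n) σ (by omega) hσ0 (by linarith) (GameReduction.meanE n σ)
    (GameReduction.meanD A B σ)
    (fun i j => by
      have := GameReduction.endowBase_mem (n := n) i j
      simp only [GameReduction.meanE, Matrix.of_apply]
      constructor <;> linarith [this.1, this.2])
    (fun i j => by
      have := GameReduction.demandBase_mem hA hB i j
      simp only [GameReduction.meanD, Matrix.of_apply]
      constructor <;> linarith [this.1, this.2])
  have hreal : 300 * (n : ℝ) ^ 2 + c * ((n + n : ℕ) : ℝ) ^ k₁ * (1 / σ) ^ k₂ ≤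
      (300 + c * 2 ^ k₁ * 512 ^ k₂) * (n : ℝ) ^ (k₁ + k₂ + 2) * (1 / ε) ^ k₂ := by
    have h1 : (1 : ℝ) ≤ (1 / ε) ^ k₂ := one_le_pow₀ (by rw [le_div_iff₀ hε]; linarith)
    have h2 : c * ((n + n : ℕ) : ℝ) ^ k₁ * (1 / σ) ^ k₂ =
        c * 2 ^ k₁ * 512 ^ k₂ * (n : ℝ) ^ (k₁ + k₂) * (1 / ε) ^ k₂ := by
      have e1 : ((n + n : ℕ) : ℝ) = 2 * n := by push_cast; ring
      have e2 : 1 / σ = 512 * n * (1 / ε) := by rw [hσ]; field_simp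
      rw [e1, e2, mul_pow, mul_pow, mul_pow, pow_add]
      ring
    have h3 : (n : ℝ) ^ (k₁ + k₂) ≤ (n : ℝ) ^ (k₁ + k₂ + 2) :=
      pow_le_pow_right₀ hn1 (by omega)
    have h4 : (n : ℝ) ^ 2 ≤ (n : ℝ) ^ (k₁ + k₂ + 2) * (1 / ε) ^ k₂ :=
      (pow_le_pow_right₀ hn1 (by omega)).trans (le_mul_of_one_le_right (by positivity) h1)
    have h5 : c * 2 ^ k₁ * 512 ^ k₂ * (n : ℝ) ^ (k₁ + k₂) * (1 / ε) ^ k₂ ≤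
        c * 2 ^ k₁ * 512 ^ k₂ * (n : ℝ) ^ (k₁ + k₂ + 2) * (1 / ε) ^ k₂ := by gcongr
    rw [h2]
    linarith
  calc ∫⁻ ω, RealRAM.runTime Φ (GameReduction.gameProg W) (Bimatrix.input A B ε ω)
        ∂(RealRAM.seedLaw)
      ≤ ∫⁻ ω, (((300 * n ^ 2 : ℕ) : ℝ≥0∞) + RealRAM.runTime Φ W (Leontief.input
          (GameReduction.randE n σ (RealRAM.noise σ (GameReduction.drawIndex (n + n)) ω).1)
          (GameReduction.randD A B σ (RealRAM.noise σ (GameReduction.drawIndex (n + n)) ω).2)))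
          ∂(RealRAM.seedLaw) :=
        MeasureTheory.lintegral_mono fun ω =>
          GameReduction.runTime_gameProg_le hW.1 hn hA hB hε hσ ω
    _ ≤ ((300 * n ^ 2 : ℕ) : ℝ≥0∞) +
          ENNReal.ofReal (c * ((n + n : ℕ) : ℝ) ^ k₁ * (1 / σ) ^ k₂) := by
        rw [MeasureTheory.lintegral_add_left measurable_const, MeasureTheory.lintegral_const,
          MeasureTheory.measure_univ, mul_one]
        gcongr
        exact (GameReduction.lintegral_runTime_le hΦ W hn hA hB hσ0).trans hexp
    _ = ENNReal.ofReal (300 * (n : ℝ) ^ 2 + c * ((n + n : ℕ) : ℝ) ^ k₁ * (1 / σ) ^ k₂) := by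
        rw [ENNReal.ofReal_add (by positivity) (by positivity), ← ENNReal.ofReal_natCast]
        push_cast
        rfl
    _ ≤ _ := ENNReal.ofReal_le_ofReal hreal
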